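/- Let $\mathbb D$ be the unit disc of $\mathbb C$ and $\mathcal O(\mathbb D^2)$ the ring of holomorphic functions on the bidisc $\mathbb D^2\subset\mathbb C^2$. For a finite set $S\subset\mathbb D^2$ let $\mathcal I(S)\subset\mathcal O(\mathbb D^2)$ be the ideal of the functions vanishing on $S$, and let $$G_S(z)=\sup\{u(z): u\in PSH_-(\mathbb D^2),\ u\le \max_j\log|\psi_j|+O(1)\},$$ where $PSH_-(\mathbb D^2)$ is the set of nonpositive plurisubharmonic functions on $\mathbb D^2$, $(\psi_j)$ is a finite set of generators of $\mathcal I(S)$, and the $O(1)$ condition is imposed near each point of the zero locus of $\mathcal I(S)$ (it does not depend on the choice of the generators). Let $E\subset\mathbb C\setminus\{0\}$ with $0\in\overline E$ and let $\rho,\delta:E\to\mathbb C\setminus\{0\}$ be such that $|\rho(\varepsilon)|\le|\varepsilon|$ and $|\rho(\varepsilon)|\le|\rho(\varepsilon)-\varepsilon|$ for all $\varepsilon\in E$ (for example $|\rho(\varepsilon)|\le\frac12|\varepsilon|$), and $\delta(\varepsilon)\to0$ as $E\ni\varepsilon\to0$. Put $S_\varepsilon=\{(0,0),(\varepsilon,0),(\rho(\varepsilon),\delta(\varepsilon)\rho(\varepsilon))\}$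 and $G_\varepsilon=G_{S_\varepsilon}$. If $$\frac{\log|\delta(\varepsilon)|}{\log|\varepsilon|}\longrightarrow0\quad\text{as }E\ni\varepsilon\to0,$$ then for every $z=(z_1,z_2)\in\mathbb D^2\setminus\{(0,0)\}$ with $|z_2|\ge|z_1|$, $$\lim_{E\ni\varepsilon\to0}G_\varepsilon(z)=\tfrac32\log|z_2|.$$ -/

import Mathlib

open Filter Topology Set

namespace PluriGreen

/-- Subharmonic functions on an open set `U ⊆ ℂ`, with values in `[-∞, ∞)`: upper semicontinuous,
and below every harmonic majorant. The function `-∞` is allowed. -/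
def SubharmonicOn (u : ℂ → EReal) (U : Set ℂ) : Prop :=
  UpperSemicontinuousOn u U ∧ (∀ z ∈ U, u z < ⊤) ∧
    ∀ K : Set ℂ, IsCompact K → K ⊆ U →
      ∀ h : ℂ → ℝ, ContinuousOn h K → InnerProductSpace.HarmonicOnNhd h (interior K) →
        (∀ z ∈ frontier K, u z ≤ (h z : EReal)) → ∀ z ∈ K, u z ≤ (h z : EReal)

section

variable {E : Type*} [NormedAddCommGroup E] [NormedSpace ℂ E]

/-- Plurisubharmonic functions on an open set `Ω`: upper semicontinuous, with values in `[-∞, ∞)`,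
and subharmonic along every holomorphic disc `φ : 𝔻 → Ω`. -/
def PlurisubharmonicOn (u : E → EReal) (Ω : Set E) : Prop :=
  UpperSemicontinuousOn u Ω ∧ (∀ z ∈ Ω, u z < ⊤) ∧
    ∀ φ : ℂ → E, DifferentiableOn ℂ φ (Metric.ball 0 1) → MapsTo φ (Metric.ball 0 1) Ω →
      SubharmonicOn (u ∘ φ) (Metric.ball 0 1)

/-- The set `PSH₋(Ω)` of nonpositive plurisubharmonic functions on `Ω`. -/
def PSHNonpos (Ω : Set E) : Set (E → EReal) :=
  {u | PlurisubharmonicOn u Ω ∧ ∀ z ∈ Ω, u z ≤ 0}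

/-- The algebra `𝒪(Ω)` of holomorphic functions on an open set `Ω`. -/
def holo (Ω : Set E) : Subalgebra ℂ (Ω → ℂ) where
  carrier := {f | ∃ F : E → ℂ, DifferentiableOn ℂ F Ω ∧ ∀ z : Ω, f z = F z}
  mul_mem' := by
    rintro f g ⟨F, hF, hf⟩ ⟨G, hG, hg⟩
    exact ⟨fun z => F z * G z, hF.mul hG, fun z => by simp [hf, hg]⟩
  add_mem' := by
    rintro f g ⟨F, hF, hf⟩ ⟨G, hG, hg⟩
    exact ⟨fun z => F z + G z, hF.add hG, fun z => by simp [hf, hg]⟩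
  algebraMap_mem' := fun c => ⟨fun _ => c, differentiableOn_const c, fun _ => rfl⟩

/-- The ideal `ℐ(S)` of all holomorphic functions on `Ω` that vanish on `S`. -/
def vanishingIdeal (Ω S : Set E) : Ideal (holo Ω) where
  carrier := {f | ∀ z : Ω, (z : E) ∈ S → f.1 z = 0}
  add_mem' := by
    intro f g hf hg z hz
    simp [hf z hz, hg z hz]
  zero_mem' := fun _ _ => rfl
  smul_mem' := by
    intro c f hf z hz
    simp [hf z hz]

/-- The common zero locus `V(ℐ)` in `Ω`. -/
def zeroLocus {Ω : Set E} (I : Ideal (holo Ω)) : Set Ω :=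
  {z | ∀ f ∈ I, f.1 z = 0}

/-- `u ≤ max_j log |ψ_j| + O(1)` near each point of `V(ℐ)`, for a finite set of generators `ψ_j`
of the ideal `ℐ`. Here `log 0 = -∞`. The condition does not depend on the generators. -/
def HasSingularity {Ω : Set E} (I : Ideal (holo Ω)) (u : E → EReal) : Prop :=
  ∃ ψ : Finset (holo Ω), Ideal.span (ψ : Set (holo Ω)) = I ∧
    ∀ a ∈ zeroLocus I, ∃ C : ℝ, ∀ᶠ z : Ω in 𝓝 a,
      u z ≤ (⨆ f ∈ ψ, ENNReal.log ‖f.1 z‖ₑ) + (C : EReal)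

/-- The pluricomplex Green function `G_ℐ^Ω` of an ideal `ℐ` of `𝒪(Ω)`. -/
noncomputable def greenIdeal {Ω : Set E} (I : Ideal (holo Ω)) (z : E) : EReal :=
  sSup {t : EReal | ∃ u ∈ PSHNonpos Ω, HasSingularity I u ∧ t = u z}

/-- The pluricomplex Green function `G_S^Ω = G_{ℐ(S)}^Ω` of a set of poles `S`. -/
noncomputable def green (Ω S : Set E) (z : E) : EReal :=
  greenIdeal (vanishingIdeal Ω S) z

end

/-- The unit bidisc `𝔻²` of `ℂ²`. -/
def bidisc : Set (ℂ × ℂ) :=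
  Metric.ball (0 : ℂ) 1 ×ˢ Metric.ball (0 : ℂ) 1

/-- The three poles `(0, 0)`, `(ε, 0)`, `(ρ, δ ρ)`. -/
def poles (ε ρ δ : ℂ) : Set (ℂ × ℂ) :=
  {(0, 0), (ε, 0), (ρ, δ * ρ)}

end PluriGreen

/-! The value is squeezed between one explicit competitor and one explicit holomorphic disc.

Lower bound: multiply the equations of the three lines through pairs of poles. Each pole lies on two
of them, so half the logarithm of the modulus has logarithmic singularities at all poles, and after
normalization it is a competitor (`log_lineProduct_le_green`). As `δ → 0` the three lines collapse
to `z₂ = 0`, so this competitor tends to `(3/2) log |z₂|` (`tendsto_log_lineProduct`). That it is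
admissible for `ℐ(S)` needs explicit generators of the ideal (`exists_span_eq_vanishingIdeal`).

Upper bound: a competitor restricted to an analytic disc through the poles at parameters `0, s, t`
is subharmonic with three logarithmic poles, hence at most `log |ζ₀ (ζ₀ - s) (ζ₀ - t)|` up to an
error that vanishes as `s, t → 0` (`green_le_of_disc`). For `cubicDisc`, `ζ₀ (ζ₀ - s) = z₂` forces
`|ζ₀| → |z₂|^(1/2)`, which gives the exponent `3/2`. The node equations make `|s|²` comparable to
`|δ ε|` (`exists_node`), so the linear coefficient `ε / s` has size `|ε / δ|^(1/2)`. The logarithmic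
hypothesis makes it tend to `0`; the limit disc is `(c ζ², ζ²)` with `c = z₁ / z₂`, and `|z₁| ≤
|z₂|` keeps it in the bidisc. -/

namespace PluriGreen

/-! ### Subharmonicity of `p log |f|` -/

/-- Maximum principle for `‖f‖ exp (-h)`, with `f` holomorphic and `h` harmonic. -/
theorem norm_le_exp_of_frontier {f : ℂ → ℂ} {U K : Set ℂ} (hU : IsOpen U)
    (hf : DifferentiableOn ℂ f U) (hK : IsCompact K) (hKU : K ⊆ U) {h : ℂ → ℝ}
    (hc : ContinuousOn h K) (hh : InnerProductSpace.HarmonicOnNhd h (interior K)) {p : ℝ}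
    (hb : ∀ z ∈ frontier K, ‖f z‖ ≤ Real.exp (p * h z)) :
    ∀ z ∈ K, ‖f z‖ ≤ Real.exp (p * h z) := by
  set q : ℂ → ℝ := fun z => ‖f z‖ * Real.exp (-(p * h z)) with hq
  have hq_iff : ∀ z, q z ≤ 1 ↔ ‖f z‖ ≤ Real.exp (p * h z) := fun z => by
    rw [hq]
    simp only [Real.exp_neg, ← div_eq_mul_inv]
    rw [div_le_one (Real.exp_pos _)]
  have hqc : ContinuousOn q K :=
    (hf.continuousOn.mono hKU).norm.mul (continuousOn_const.mul hc).neg.rexp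
  by_contra! hcon
  obtain ⟨x, hxK, hx⟩ := hcon
  obtain ⟨m, hmK, hm⟩ := hK.exists_isMaxOn ⟨x, hxK⟩ hqc
  have hm1 : 1 < q m := lt_of_lt_of_le
    (not_le.1 fun h1 => hx.not_ge ((hq_iff x).1 h1)) (hm hxK)
  -- The set of maximum points avoids the frontier of `K`; it turns out to be clopen in `ℂ`, hence
  -- all of `ℂ`, against compactness.
  set M : Set ℂ := {z ∈ K | q z = q m} with hM
  have hMint : ∀ z ∈ M, z ∈ interior K := by
    intro z hz
    by_contra hzi
    have := (hq_iff z).2 (hb z ⟨subset_closure hz.1, hzi⟩)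
    rw [hz.2] at this
    linarith
  have hMclosed : IsClosed M :=
    hqc.preimage_isClosed_of_isClosed hK.isClosed (isClosed_singleton (x := q m))
  have hMopen : IsOpen M := by
    rw [isOpen_iff_mem_nhds]
    intro z hz
    obtain ⟨r, hr, hball⟩ := Metric.isOpen_iff.1 isOpen_interior z (hMint z hz)
    -- Locally `h = Re g`, so `q` is the modulus of the holomorphic function `f exp (-p g)`.
    obtain ⟨g, hg, hgh⟩ := InnerProductSpace.HarmonicOnNhd.exists_analyticOnNhd_ball_re_eq
      (hh.mono hball)
    have hnorm : ∀ w ∈ Metric.ball z r, ‖f w * Complex.exp (-(p * g w))‖ = q w := by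
      intro w hw
      rw [norm_mul, Complex.norm_exp]
      have : (g w).re = h w := hgh hw
      simp [hq, this]
    have hd : ∀ᶠ w in 𝓝 z, DifferentiableAt ℂ (fun w => f w * Complex.exp (-(p * g w))) w := by
      filter_upwards [Metric.ball_mem_nhds z hr] with w hw
      have h1 : DifferentiableAt ℂ f w :=
        hf.differentiableAt (hU.mem_nhds (hKU (interior_subset (hball hw))))
      have h2 : DifferentiableAt ℂ g w := (hg w hw).differentiableAt
      fun_prop
    have hloc : IsLocalMax (norm ∘ fun w => f w * Complex.exp (-(p * g w))) z := by
      filter_upwards [Metric.ball_mem_nhds z hr] with w hw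
      simp only [Function.comp_apply]
      rw [hnorm w hw, hnorm z (Metric.mem_ball_self hr), hz.2]
      exact hm (interior_subset (hball hw))
    filter_upwards [Complex.norm_eventually_eq_of_isLocalMax hd hloc, Metric.ball_mem_nhds z hr]
      with w hw hwb
    rw [hnorm w hwb, hnorm z (Metric.mem_ball_self hr), hz.2] at hw
    exact ⟨interior_subset (hball hwb), hw⟩
  have huniv : M = univ := IsClopen.eq_univ ⟨hMclosed, hMopen⟩ ⟨m, hmK, rfl⟩
  have : IsCompact (univ : Set ℂ) :=
    huniv ▸ hK.of_isClosed_subset hMclosed (sep_subset _ _)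
  exact noncompact_univ ℂ this

theorem log_rpow_enorm_le_iff {x : ℂ} {p h : ℝ} (hp : 0 < p) :
    ENNReal.log (‖x‖ₑ ^ p) ≤ (h : EReal) ↔ ‖x‖ ≤ Real.exp (p⁻¹ * h) := by
  have h1 : (h : EReal) = ENNReal.log (ENNReal.ofReal (Real.exp h)) := by
    rw [ENNReal.log_ofReal_of_pos (Real.exp_pos _), Real.log_exp]
  rw [h1, ENNReal.log_le_log_iff, ← ofReal_norm,
    ENNReal.ofReal_rpow_of_nonneg (norm_nonneg _) hp.le,
    ENNReal.ofReal_le_ofReal_iff (Real.exp_pos _).le, mul_comm, Real.exp_mul,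
    Real.le_rpow_inv_iff_of_pos (norm_nonneg _) (Real.exp_pos _).le hp]

theorem subharmonicOn_log_rpow_enorm {f : ℂ → ℂ} {U : Set ℂ} (hU : IsOpen U)
    (hf : DifferentiableOn ℂ f U) {p : ℝ} (hp : 0 < p) :
    SubharmonicOn (fun z => ENNReal.log (‖f z‖ₑ ^ p)) U := by
  refine ⟨?_, ?_, ?_⟩
  · refine ContinuousOn.upperSemicontinuousOn ?_
    exact ENNReal.continuous_log.comp_continuousOn
      ((ENNReal.continuous_rpow_const (y := p)).comp_continuousOn hf.continuousOn.enorm)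
  · intro z _
    rw [ENNReal.log_lt_top_iff]
    exact ENNReal.rpow_lt_top_of_nonneg hp.le enorm_ne_top
  · intro K hK hKU h hc hh hb z hz
    rw [log_rpow_enorm_le_iff hp]
    refine norm_le_exp_of_frontier hU hf hK hKU hc hh (fun w hw => ?_) z hz
    exact (log_rpow_enorm_le_iff hp).1 (hb w hw)

theorem plurisubharmonicOn_log_rpow_enorm {E : Type*} [NormedAddCommGroup E] [NormedSpace ℂ E]
    {f : E → ℂ} {Ω : Set E} (hf : DifferentiableOn ℂ f Ω) {p : ℝ} (hp : 0 < p) :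
    PlurisubharmonicOn (fun z => ENNReal.log (‖f z‖ₑ ^ p)) Ω := by
  refine ⟨?_, ?_, ?_⟩
  · refine ContinuousOn.upperSemicontinuousOn ?_
    exact ENNReal.continuous_log.comp_continuousOn
      ((ENNReal.continuous_rpow_const (y := p)).comp_continuousOn hf.continuousOn.enorm)
  · intro z _
    rw [ENNReal.log_lt_top_iff]
    exact ENNReal.rpow_lt_top_of_nonneg hp.le enorm_ne_top
  · intro φ hφ hφΩ
    exact subharmonicOn_log_rpow_enorm Metric.isOpen_ball (hf.comp hφ hφΩ) hp

/-! ### Subharmonic functions with logarithmic poles in the disc -/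

theorem log_enorm_eq {x : ℂ} (hx : x ≠ 0) : ENNReal.log ‖x‖ₑ = (Real.log ‖x‖ : ℝ) := by
  rw [← ofReal_norm, ENNReal.log_ofReal_of_pos (norm_pos_iff.2 hx)]

/-- Compactness merges the local `O(1)` constants into one: near any point, the factors that do not
vanish there are bounded below. -/
theorem exists_le_log_norm_prod_add {w : ℂ → EReal} {Z : Finset ℂ} {K : Set ℂ} (hK : IsCompact K)
    (hw0 : ∀ᶠ ζ in 𝓝ˢ K, w ζ ≤ 0)
    (hZ : ∀ a ∈ Z, ∃ C : ℝ, ∀ᶠ ζ in 𝓝 a, w ζ ≤ ENNReal.log ‖ζ - a‖ₑ + (C : EReal)) :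
    ∃ C : ℝ, ∀ ζ ∈ K, ∏ a ∈ Z, (ζ - a) ≠ 0 →
      w ζ ≤ ((Real.log ‖∏ a ∈ Z, (ζ - a)‖ + C : ℝ) : EReal) := by
  refine hK.induction_on (p := fun s => ∃ C : ℝ, ∀ ζ ∈ s, ∏ a ∈ Z, (ζ - a) ≠ 0 →
      w ζ ≤ ((Real.log ‖∏ a ∈ Z, (ζ - a)‖ + C : ℝ) : EReal)) ⟨0, by simp⟩ ?_ ?_ ?_
  · rintro s t hst ⟨C, hC⟩
    exact ⟨C, fun ζ hζ => hC ζ (hst hζ)⟩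
  · rintro s t ⟨C, hC⟩ ⟨D, hD⟩
    refine ⟨max C D, ?_⟩
    rintro ζ (hζ | hζ) hne
    · refine (hC ζ hζ hne).trans (EReal.coe_le_coe_iff.2 ?_)
      gcongr
      exact le_max_left _ _
    · refine (hD ζ hζ hne).trans (EReal.coe_le_coe_iff.2 ?_)
      gcongr
      exact le_max_right _ _
  · intro x hx
    have key : ∃ C : ℝ, ∀ᶠ ζ in 𝓝 x, ∏ a ∈ Z, (ζ - a) ≠ 0 →
        w ζ ≤ ((Real.log ‖∏ a ∈ Z, (ζ - a)‖ + C : ℝ) : EReal) := by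
      by_cases hxZ : x ∈ Z
      · obtain ⟨C, hC⟩ := hZ x hxZ
        set q : ℂ → ℂ := fun ζ => ∏ a ∈ Z.erase x, (ζ - a) with hq
        have hqx : 0 < ‖q x‖ := by
          rw [norm_pos_iff, hq]
          exact Finset.prod_ne_zero_iff.2 fun a ha => sub_ne_zero.2 (Finset.ne_of_mem_erase ha).symm
        have hqc : Continuous q := by fun_prop
        refine ⟨C - Real.log (‖q x‖ / 2), ?_⟩
        filter_upwards [hC, hqc.norm.continuousAt.eventually (lt_mem_nhds (half_lt_self hqx))]
          with ζ h1 h2 hne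
        have hfac : ∏ a ∈ Z, (ζ - a) = (ζ - x) * q ζ := (Finset.mul_prod_erase Z _ hxZ).symm
        rw [hfac] at hne ⊢
        have hne1 : ζ - x ≠ 0 := left_ne_zero_of_mul hne
        have hne2 : q ζ ≠ 0 := right_ne_zero_of_mul hne
        rw [log_enorm_eq hne1, ← EReal.coe_add] at h1
        refine h1.trans (EReal.coe_le_coe_iff.2 ?_)
        rw [norm_mul, Real.log_mul (norm_ne_zero_iff.2 hne1) (norm_ne_zero_iff.2 hne2)]
        have := Real.log_le_log (by positivity) h2.le
        linarith
      · set q : ℂ → ℂ := fun ζ => ∏ a ∈ Z, (ζ - a) with hq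
        have hqx : 0 < ‖q x‖ := by
          rw [norm_pos_iff, hq]
          exact Finset.prod_ne_zero_iff.2 fun a ha => sub_ne_zero.2 fun h => hxZ (h ▸ ha)
        have hqc : Continuous q := by fun_prop
        refine ⟨- Real.log (‖q x‖ / 2), ?_⟩
        have hw0x : ∀ᶠ ζ in 𝓝 x, w ζ ≤ 0 :=
          hw0.filter_mono (nhds_le_nhdsSet hx)
        filter_upwards [hw0x, hqc.norm.continuousAt.eventually (lt_mem_nhds (half_lt_self hqx))]
          with ζ h1 h2 hne
        refine h1.trans ?_
        rw [← EReal.coe_zero, EReal.coe_le_coe_iff]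
        have := Real.log_le_log (by positivity) h2.le
        linarith
    obtain ⟨C, hC⟩ := key
    exact ⟨_, mem_nhdsWithin_of_mem_nhds hC, C, fun ζ hζ => hζ⟩

/-- Harmonic majorants must be finite, so neighbourhoods `‖q‖ < τ` of the poles are cut out of the
disc of radius `s`. On the circle `‖q‖ ≥ m`, so the majorant is nonnegative there; the loss `1 - η`
lets it absorb the constant `C` where `‖q‖ = τ`. -/
theorem le_mul_log_of_subharmonicOn {w : ℂ → EReal} (hw : SubharmonicOn w (Metric.ball 0 1))
    (hw0 : ∀ ζ ∈ Metric.ball (0 : ℂ) 1, w ζ ≤ 0) {Z : Finset ℂ}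
    (hZ : ∀ a ∈ Z, ∃ C : ℝ, ∀ᶠ ζ in 𝓝 a, w ζ ≤ ENNReal.log ‖ζ - a‖ₑ + (C : EReal))
    {s : ℝ} (hs1 : s < 1) (hZs : ∀ a ∈ Z, ‖a‖ < s) {ζ₀ : ℂ} (hζs : ‖ζ₀‖ ≤ s)
    (hζ₀ : ζ₀ ∉ Z) {η : ℝ} (hη0 : 0 < η) (hη1 : η < 1) :
    w ζ₀ ≤ (((1 - η) * (Real.log ‖∏ a ∈ Z, (ζ₀ - a)‖ - Real.log (∏ a ∈ Z, (s - ‖a‖))) : ℝ) :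
      EReal) := by
  set q : ℂ → ℂ := fun ζ => ∏ a ∈ Z, (ζ - a) with hq
  have hqc : Continuous q := by fun_prop
  set m : ℝ := ∏ a ∈ Z, (s - ‖a‖) with hm
  have hm0 : 0 < m := Finset.prod_pos fun a ha => sub_pos.2 (hZs a ha)
  have hs_ball : Metric.closedBall (0 : ℂ) s ⊆ Metric.ball 0 1 :=
    Metric.closedBall_subset_ball hs1
  obtain ⟨C, hC⟩ := exists_le_log_norm_prod_add (isCompact_closedBall (0 : ℂ) s)
    (Filter.mem_of_superset ((Metric.isOpen_ball.mem_nhdsSet).2 hs_ball) hw0) hZ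
  have hqζ : 0 < ‖q ζ₀‖ := by
    rw [norm_pos_iff, hq]
    exact Finset.prod_ne_zero_iff.2 fun a ha => sub_ne_zero.2 fun h => hζ₀ (h ▸ ha)
  -- The first term keeps `ζ₀` in `K`; the second says `η log τ ≤ -(1 - η) log m - C`, which is the
  -- required inequality on `‖q‖ = τ`.
  set τ : ℝ := min ‖q ζ₀‖ (Real.exp ((-(1 - η) * Real.log m - C) / η)) with hτ
  have hτ0 : 0 < τ := lt_min hqζ (Real.exp_pos _)
  set K : Set ℂ := Metric.closedBall 0 s ∩ {ζ | τ ≤ ‖q ζ‖} with hK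
  have hKc : IsCompact K :=
    (isCompact_closedBall (0 : ℂ) s).inter_right (isClosed_le continuous_const hqc.norm)
  have hqK : ∀ ζ ∈ K, q ζ ≠ 0 := fun ζ hζ => norm_pos_iff.1 (hτ0.trans_le hζ.2)
  refine hw.2.2 K hKc (inter_subset_left.trans hs_ball)
    (fun ζ => (1 - η) * (Real.log ‖q ζ‖ - Real.log m)) ?_ ?_ ?_ ζ₀
    ⟨by simpa using hζs, show τ ≤ ‖q ζ₀‖ from min_le_left _ _⟩
  · refine continuousOn_const.mul (ContinuousOn.sub ?_ continuousOn_const)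
    exact hqc.norm.continuousOn.log fun ζ hζ => norm_ne_zero_iff.2 (hqK ζ hζ)
  · intro ζ hζ
    have hqa : AnalyticAt ℂ q ζ := by
      have : Differentiable ℂ q := by fun_prop
      exact this.analyticAt ζ
    have h1 := hqa.harmonicAt_log_norm (hqK ζ (interior_subset hζ))
    have h2 : InnerProductSpace.HarmonicAt (fun _ : ℂ => Real.log m) ζ := by
      simp
    exact (h1.sub h2).const_smul (c := 1 - η)
  · intro ζ hζ
    have hζK : ζ ∈ K := hKc.isClosed.frontier_subset hζ
    rcases frontier_inter_subset _ _ hζ with h | h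
    · have hnorm : ‖ζ‖ = s := by
        simpa using Metric.frontier_closedBall_subset_sphere h.1
      refine (hw0 ζ (hs_ball hζK.1)).trans ?_
      rw [← EReal.coe_zero, EReal.coe_le_coe_iff]
      refine mul_nonneg (by linarith) (sub_nonneg.2 (Real.log_le_log hm0 ?_))
      rw [hq, hm, norm_prod]
      refine Finset.prod_le_prod (fun a ha => (sub_pos.2 (hZs a ha)).le) fun a _ => ?_
      rw [← hnorm]
      exact norm_sub_norm_le _ _
    · have hnorm : τ = ‖q ζ‖ := frontier_le_subset_eq continuous_const hqc.norm h.2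
      refine (hC ζ hζK.1 (hqK ζ hζK)).trans (EReal.coe_le_coe_iff.2 ?_)
      change Real.log ‖q ζ‖ + C ≤ _
      rw [← hnorm]
      have h1 : Real.log τ ≤ (-(1 - η) * Real.log m - C) / η := by
        rw [Real.log_le_iff_le_exp hτ0]
        exact min_le_right _ _
      rw [le_div_iff₀ hη0] at h1
      linarith

/-- A nonpositive subharmonic function on the unit disc with logarithmic poles at the points of `Z`
is bounded by a sum of logarithms. -/
theorem le_log_of_subharmonicOn {w : ℂ → EReal} (hw : SubharmonicOn w (Metric.ball 0 1))
    (hw0 : ∀ ζ ∈ Metric.ball (0 : ℂ) 1, w ζ ≤ 0) {Z : Finset ℂ}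
    (hZ : ∀ a ∈ Z, ∃ C : ℝ, ∀ᶠ ζ in 𝓝 a, w ζ ≤ ENNReal.log ‖ζ - a‖ₑ + (C : EReal))
    (hZ1 : ∀ a ∈ Z, ‖a‖ < 1) {ζ₀ : ℂ} (hζ1 : ‖ζ₀‖ < 1) (hζ₀ : ζ₀ ∉ Z) :
    w ζ₀ ≤ ((Real.log ‖∏ a ∈ Z, (ζ₀ - a)‖ - Real.log (∏ a ∈ Z, (1 - ‖a‖)) : ℝ) : EReal) := by
  have hm0 : 0 < ∏ a ∈ Z, (1 - ‖a‖) := Finset.prod_pos fun a ha => sub_pos.2 (hZ1 a ha)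
  -- A single parameter `η → 0` removes the factor `1 - η` and lets the radius `s = 1 - η` grow to
  -- `1`.
  have hlim : Tendsto (fun η : ℝ => (((1 - η) * (Real.log ‖∏ a ∈ Z, (ζ₀ - a)‖ -
      Real.log (∏ a ∈ Z, ((1 - η) - ‖a‖))) : ℝ) : EReal)) (𝓝[>] 0)
      (𝓝 ((Real.log ‖∏ a ∈ Z, (ζ₀ - a)‖ - Real.log (∏ a ∈ Z, (1 - ‖a‖)) : ℝ) : EReal)) := by
    refine (continuous_coe_real_ereal.tendsto _).comp (tendsto_nhdsWithin_of_tendsto_nhds ?_)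
    have : ContinuousAt (fun η : ℝ => (1 - η) * (Real.log ‖∏ a ∈ Z, (ζ₀ - a)‖ -
      Real.log (∏ a ∈ Z, ((1 - η) - ‖a‖)))) 0 := by
      refine ContinuousAt.mul (by fun_prop) (ContinuousAt.sub (by fun_prop) ?_)
      refine ContinuousAt.log (by fun_prop) ?_
      simpa using hm0.ne'
    simpa [ContinuousAt] using this
  refine ge_of_tendsto hlim ?_
  have hev : ∀ b : ℝ, b < 1 → ∀ᶠ η : ℝ in 𝓝[>] 0, b < 1 - η := fun b hb =>
    tendsto_nhdsWithin_of_tendsto_nhds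
      (by simpa using (tendsto_const_nhds (x := (1 : ℝ))).sub (tendsto_id (α := ℝ) (x := 𝓝 0)))
      |>.eventually (lt_mem_nhds hb)
  have hevZ : ∀ᶠ η : ℝ in 𝓝[>] 0, ∀ a ∈ Z, ‖a‖ < 1 - η :=
    (Finset.eventually_all Z).2 fun a ha => hev _ (hZ1 a ha)
  filter_upwards [hev _ hζ1, hevZ, hev 0 one_pos, self_mem_nhdsWithin] with η h1 h2 h3 h4
  have h4 : 0 < η := h4
  exact le_mul_log_of_subharmonicOn hw hw0 hZ (by linarith) h2 h1.le hζ₀ h4 (by linarith)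

/-! ### Division by coordinate differences on the bidisc -/

/-- `H` is bounded by `M` and separately holomorphic on the polydisc of radius `r` about
`(a, b)`. -/
structure SepHolo (H : ℂ → ℂ → ℂ) (a b : ℂ) (r M : ℝ) : Prop where
  norm_le : ∀ x ∈ Metric.ball a r, ∀ y ∈ Metric.ball b r, ‖H x y‖ ≤ M
  left : ∀ y ∈ Metric.ball b r, DifferentiableOn ℂ (fun x => H x y) (Metric.ball a r)
  right : ∀ x ∈ Metric.ball a r, DifferentiableOn ℂ (fun y => H x y) (Metric.ball b r)

namespace SepHolo

variable {H : ℂ → ℂ → ℂ} {a b : ℂ} {r M : ℝ}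

theorem norm_dslope_le (h : SepHolo H a b r M) {x y : ℂ} (hx : x ∈ Metric.ball a r)
    (hy : y ∈ Metric.ball b r) : ‖dslope (fun w => H w y) a x‖ ≤ 2 * M / r := by
  refine Complex.norm_dslope_le_div_of_mapsTo_ball (h.left y hy) (fun w hw => ?_) hx
  have ha : a ∈ Metric.ball a r :=
    Metric.mem_ball_self (dist_nonneg.trans_lt (Metric.mem_ball.1 hx))
  rw [mem_closedBall_iff_norm]
  linarith [norm_sub_le (H w y) (H a y), h.norm_le w hw y hy, h.norm_le a ha y hy]

theorem differentiableOn_dslope (h : SepHolo H a b r M) {y : ℂ} (hr : 0 < r)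
    (hy : y ∈ Metric.ball b r) :
    DifferentiableOn ℂ (fun x => dslope (fun w => H w y) a x) (Metric.ball a r) :=
  (Complex.differentiableOn_dslope (Metric.ball_mem_nhds a hr)).2 (h.left y hy)

theorem norm_dslope_sub_le (h : SepHolo H a b r M) (hr : 0 < r) {x y : ℂ}
    (hx : x ∈ Metric.ball a r) (hy : y ∈ Metric.ball b r) :
    ‖dslope (fun w => H w y) a x - dslope (fun w => H w y) a a‖ ≤
      ‖x - a‖ * (2 * (2 * M / r) / r) := by
  rw [← sub_smul_dslope, norm_smul]
  refine mul_le_mul_of_nonneg_left ?_ (norm_nonneg _)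
  refine Complex.norm_dslope_le_div_of_mapsTo_ball (h.differentiableOn_dslope hr hy)
    (fun w hw => ?_) hx
  rw [mem_closedBall_iff_norm]
  linarith [norm_sub_le (dslope (fun w => H w y) a w) (dslope (fun w => H w y) a a),
    h.norm_dslope_le hw hy, h.norm_dslope_le (Metric.mem_ball_self hr) hy]

/-- The bound is the Schwarz lemma. In the second variable, the value at `x = a` is a locally
uniform limit of difference quotients, which are holomorphic in `y`. -/
theorem dslope (h : SepHolo H a b r M) (hr : 0 < r) :
    SepHolo (fun x y => dslope (fun w => H w y) a x) a b r (2 * M / r) where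
  norm_le _ hx _ hy := h.norm_dslope_le hx hy
  left _ hy := h.differentiableOn_dslope hr hy
  right x hx := by
    have hne : ∀ x ∈ Metric.ball a r, x ≠ a →
        DifferentiableOn ℂ (fun y => _root_.dslope (fun w => H w y) a x) (Metric.ball b r) := by
      intro x hx hxa
      simp only [dslope_of_ne _ hxa, slope_def_field]
      exact ((h.right x hx).sub (h.right a (Metric.mem_ball_self hr))).div_const _
    rcases ne_or_eq x a with hxa | rfl
    · exact hne x hx hxa
    · have hu : TendstoUniformlyOn (fun t y => _root_.dslope (fun w => H w y) x t)
          (fun y => _root_.dslope (fun w => H w y) x x) (𝓝[≠] x) (Metric.ball b r) := by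
        rw [Metric.tendstoUniformlyOn_iff]
        intro ε hε
        have hlim : Tendsto (fun t : ℂ => ‖t - x‖ * (2 * (2 * M / r) / r)) (𝓝[≠] x) (𝓝 0) := by
          refine tendsto_nhdsWithin_of_tendsto_nhds ?_
          have : Continuous fun t : ℂ => ‖t - x‖ * (2 * (2 * M / r) / r) := by fun_prop
          simpa using this.tendsto x
        filter_upwards [hlim.eventually (gt_mem_nhds hε),
          mem_nhdsWithin_of_mem_nhds (Metric.ball_mem_nhds x hr)] with t ht htb y hy
        rw [dist_comm, dist_eq_norm]
        exact (h.norm_dslope_sub_le hr htb hy).trans_lt ht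
      refine hu.tendstoLocallyUniformlyOn.differentiableOn ?_ Metric.isOpen_ball
      filter_upwards [self_mem_nhdsWithin,
        mem_nhdsWithin_of_mem_nhds (Metric.ball_mem_nhds x hr)] with t ht htb
      exact hne t htb ht

theorem eq_add_mul_dslope (x y : ℂ) :
    H x y = H a y + (x - a) * _root_.dslope (fun w => H w y) a x := by
  have := sub_smul_dslope (fun w => H w y) a x
  simp only [smul_eq_mul] at this
  rw [this]
  ring

theorem continuousAt (h : SepHolo H a b r M) (hr : 0 < r) :
    ContinuousAt (fun z : ℂ × ℂ => H z.1 z.2) (a, b) := by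
  have h1 : ContinuousAt (fun z : ℂ × ℂ => H a z.2) (a, b) :=
    ContinuousAt.comp (g := fun y => H a y) (f := Prod.snd)
      ((h.right a (Metric.mem_ball_self hr)).continuousOn.continuousAt (Metric.ball_mem_nhds b hr))
      continuous_snd.continuousAt
  have h2 : Tendsto (fun z : ℂ × ℂ => (z.1 - a) * _root_.dslope (fun w => H w z.2) a z.1)
      (𝓝 (a, b)) (𝓝 0) := by
    refine squeeze_zero_norm' (a := fun z : ℂ × ℂ => ‖z.1 - a‖ * (2 * M / r)) ?_ ?_
    · filter_upwards [prod_mem_nhds (Metric.ball_mem_nhds a hr) (Metric.ball_mem_nhds b hr)]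
        with z hz
      rw [norm_mul]
      exact mul_le_mul_of_nonneg_left (h.norm_dslope_le hz.1 hz.2) (norm_nonneg _)
    · have : Continuous fun z : ℂ × ℂ => ‖z.1 - a‖ * (2 * M / r) := by fun_prop
      simpa using this.tendsto (a, b)
  have h3 := h1.tendsto.add h2
  simp only [add_zero] at h3
  exact h3.congr fun z => (eq_add_mul_dslope z.1 z.2).symm

/-- Bounded separately holomorphic functions are holomorphic. -/
theorem differentiableAt (h : SepHolo H a b r M) (hr : 0 < r) :
    DifferentiableAt ℂ (fun z : ℂ × ℂ => H z.1 z.2) (a, b) := by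
  set G : ℂ × ℂ → ℂ := fun z => _root_.dslope (fun w => H w z.2) a z.1 with hG
  have hGc : ContinuousAt G (a, b) := (h.dslope hr).continuousAt hr
  have h1 : DifferentiableAt ℂ (fun z : ℂ × ℂ => H a z.2) (a, b) :=
    DifferentiableAt.comp (g := fun y => H a y) (f := Prod.snd) (a, b)
      ((h.right a (Metric.mem_ball_self hr)).differentiableAt (Metric.ball_mem_nhds b hr))
      differentiableAt_snd
  -- With `G` continuous at `(a, b)`, this term is `o(‖z - (a, b)‖)`; the other two terms of `H` are
  -- visibly differentiable.
  have h2 : HasFDerivAt (fun z : ℂ × ℂ => (z.1 - a) * (G z - G (a, b)))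
      (0 : ℂ × ℂ →L[ℂ] ℂ) (a, b) := by
    rw [hasFDerivAt_iff_isLittleO]
    have hO : (fun z : ℂ × ℂ => z.1 - a) =O[𝓝 (a, b)] fun z => z - (a, b) :=
      Asymptotics.isBigO_of_le _ fun z => by
        simpa using norm_fst_le (z - (a, b))
    have ho : (fun z => G z - G (a, b)) =o[𝓝 (a, b)] fun _ => (1 : ℝ) := by
      rw [Asymptotics.isLittleO_one_iff]
      simpa using hGc.tendsto.sub_const (G (a, b))
    have hho := (hO.norm_right.mul_isLittleO ho)
    simp only [mul_one] at hho
    simpa using hho.of_norm_right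
  have h3 : DifferentiableAt ℂ (fun z : ℂ × ℂ => (z.1 - a) * G (a, b)) (a, b) := by fun_prop
  refine ((h1.add h2.differentiableAt).add h3).congr_of_eventuallyEq (Eventually.of_forall ?_)
  intro z
  simp only [Pi.add_apply]
  rw [eq_add_mul_dslope (H := H) (a := a) z.1 z.2]
  ring

end SepHolo

theorem isOpen_bidisc : IsOpen bidisc := Metric.isOpen_ball.prod Metric.isOpen_ball

/-- The quotient is the divided difference in `z₁`. Only points on the line `z₁ = a` need the
`SepHolo` argument, on a small polydisc where `F` is bounded. -/
theorem exists_eq_sub_mul {F : ℂ × ℂ → ℂ} (hF : DifferentiableOn ℂ F bidisc) {a : ℂ}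
    (ha : a ∈ Metric.ball (0 : ℂ) 1) (h0 : ∀ y ∈ Metric.ball (0 : ℂ) 1, F (a, y) = 0) :
    ∃ G : ℂ × ℂ → ℂ, DifferentiableOn ℂ G bidisc ∧ ∀ z ∈ bidisc, F z = (z.1 - a) * G z := by
  have heq : ∀ z ∈ bidisc, F z = (z.1 - a) * dslope (fun w => F (w, z.2)) a z.1 := by
    intro z hz
    have := SepHolo.eq_add_mul_dslope (H := fun x y => F (x, y)) (a := a) z.1 z.2
    simpa [h0 z.2 hz.2] using this
  refine ⟨fun z => dslope (fun w => F (w, z.2)) a z.1, ?_, heq⟩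
  intro p hp
  refine DifferentiableAt.differentiableWithinAt ?_
  rcases ne_or_eq p.1 a with hpa | hpa
  · have hd : DifferentiableAt ℂ (fun z : ℂ × ℂ => F z * (z.1 - a)⁻¹) p :=
      (hF.differentiableAt (isOpen_bidisc.mem_nhds hp)).mul
        ((differentiableAt_inv (sub_ne_zero.2 hpa)).comp p (f := fun z : ℂ × ℂ => z.1 - a)
          (by fun_prop))
    refine hd.congr_of_eventuallyEq ?_
    have hne : ∀ᶠ z : ℂ × ℂ in 𝓝 p, z.1 ≠ a :=
      continuous_fst.continuousAt.eventually (isOpen_ne.mem_nhds hpa)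
    filter_upwards [hne, isOpen_bidisc.mem_nhds hp] with z hz hzb
    rw [← div_eq_mul_inv, eq_div_iff (sub_ne_zero.2 hz), heq z hzb, mul_comm]
  · obtain ⟨p₁, b⟩ := p
    obtain rfl : p₁ = a := hpa
    have hcont : ContinuousAt F (p₁, b) :=
      hF.continuousOn.continuousAt (isOpen_bidisc.mem_nhds hp)
    have hev : ∀ᶠ z in 𝓝 (p₁, b), z ∈ bidisc ∧ ‖F z‖ < ‖F (p₁, b)‖ + 1 :=
      Filter.Eventually.and (isOpen_bidisc.mem_nhds hp)
        (hcont.norm.eventually (gt_mem_nhds (lt_add_one _)))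
    obtain ⟨r, hr, hball⟩ := Metric.eventually_nhds_iff_ball.1 hev
    have hball : ∀ x ∈ Metric.ball p₁ r, ∀ y ∈ Metric.ball b r,
        (x, y) ∈ bidisc ∧ ‖F (x, y)‖ < ‖F (p₁, b)‖ + 1 := fun x hx y hy =>
      hball (x, y) (by rw [← ball_prod_same]; exact ⟨hx, hy⟩)
    have hsep : SepHolo (fun x y => F (x, y)) p₁ b r (‖F (p₁, b)‖ + 1) := by
      refine ⟨fun x hx y hy => (hball x hx y hy).2.le, fun y hy => ?_, fun x hx => ?_⟩
      · exact hF.comp (f := fun x => (x, y)) (by fun_prop) fun x hx => (hball x hx y hy).1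
      · exact hF.comp (f := fun y => (x, y)) (by fun_prop) fun y hy => (hball x hx y hy).1
    exact (hsep.dslope hr).differentiableAt hr

theorem exists_eq_prod_mul (A : Finset ℂ) : ∀ {F : ℂ × ℂ → ℂ}, DifferentiableOn ℂ F bidisc →
    (∀ a ∈ A, a ∈ Metric.ball (0 : ℂ) 1) →
    (∀ a ∈ A, ∀ y ∈ Metric.ball (0 : ℂ) 1, F (a, y) = 0) →
    ∃ G : ℂ × ℂ → ℂ, DifferentiableOn ℂ G bidisc ∧
      ∀ z ∈ bidisc, F z = (∏ a ∈ A, (z.1 - a)) * G z := by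
  induction A using Finset.induction_on with
  | empty => exact fun {F} hF _ _ => ⟨F, hF, by simp⟩
  | insert a A haA ih =>
    intro F hF hA h0
    obtain ⟨G, hG, hFG⟩ := exists_eq_sub_mul hF (hA a (Finset.mem_insert_self a A))
      (h0 a (Finset.mem_insert_self a A))
    obtain ⟨G', hG', hGG'⟩ := ih hG (fun c hc => hA c (Finset.mem_insert_of_mem hc)) (by
      intro c hc y hy
      have h1 := hFG (c, y) ⟨hA c (Finset.mem_insert_of_mem hc), hy⟩
      rw [h0 c (Finset.mem_insert_of_mem hc) y hy] at h1
      refine (mul_eq_zero.1 h1.symm).resolve_left (sub_ne_zero.2 ?_)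
      rintro rfl
      exact haA hc)
    refine ⟨G', hG', fun z hz => ?_⟩
    rw [hFG z hz, hGG' z hz, Finset.prod_insert haA, mul_assoc]

/-! ### Generators of the ideal of a finite set -/

theorem differentiable_prod {ι E : Type*} [NormedAddCommGroup E] [NormedSpace ℂ E] (A : Finset ι)
    {f : ι → E → ℂ} (hf : ∀ i, Differentiable ℂ (f i)) :
    Differentiable ℂ fun z => ∏ i ∈ A, f i z := by
  classical
  induction A using Finset.induction_on with
  | empty => simp
  | insert i A hi ih =>
    simp only [Finset.prod_insert hi]
    exact (hf i).mul ih

theorem differentiable_prod_sub {E : Type*} [NormedAddCommGroup E] [NormedSpace ℂ E] {f : E → ℂ}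
    (hf : Differentiable ℂ f) (A : Finset ℂ) : Differentiable ℂ fun z => ∏ a ∈ A, (f z - a) :=
  differentiable_prod A fun a => hf.sub_const a

/-- Divide `F` on each line `z₁ = a` by `∏ (z₂ - b)` and interpolate the quotients in `z₁` to get
`H`. Then `F - ∏ (z₂ - b) H` vanishes on these lines and is divisible by `∏ (z₁ - a)`. -/
theorem exists_eq_prod_mul_add_prod_mul {A B : Finset ℂ} (hA : ∀ a ∈ A, a ∈ Metric.ball (0 : ℂ) 1)
    (hB : ∀ b ∈ B, b ∈ Metric.ball (0 : ℂ) 1) {F : ℂ × ℂ → ℂ} (hF : DifferentiableOn ℂ F bidisc)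
    (h0 : ∀ a ∈ A, ∀ b ∈ B, F (a, b) = 0) :
    ∃ G H : ℂ × ℂ → ℂ, DifferentiableOn ℂ G bidisc ∧ DifferentiableOn ℂ H bidisc ∧
      ∀ z ∈ bidisc, F z = (∏ a ∈ A, (z.1 - a)) * G z + (∏ b ∈ B, (z.2 - b)) * H z := by
  have hslice : ∀ a ∈ A, ∃ g : ℂ → ℂ, DifferentiableOn ℂ g (Metric.ball 0 1) ∧
      ∀ y ∈ Metric.ball (0 : ℂ) 1, F (a, y) = (∏ b ∈ B, (y - b)) * g y := by
    intro a ha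
    -- One-variable division comes from the two-variable lemma by adding a dummy second variable.
    have hd : DifferentiableOn ℂ (fun z : ℂ × ℂ => F (a, z.1)) bidisc :=
      hF.comp (f := fun z : ℂ × ℂ => (a, z.1)) (by fun_prop) fun z hz => ⟨hA a ha, hz.1⟩
    obtain ⟨G, hG, hFG⟩ := exists_eq_prod_mul B hd hB fun b hb y _ => h0 a ha b hb
    refine ⟨fun y => G (y, 0), hG.comp (f := fun y => (y, (0 : ℂ))) (by fun_prop)
      fun y hy => ⟨hy, by simp⟩, fun y hy => hFG (y, 0) ⟨hy, by simp⟩⟩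
  choose! g hg hgF using hslice
  set H : ℂ × ℂ → ℂ := fun z => ∑ a ∈ A, (Lagrange.basis A id a).eval z.1 * g a z.2 with hH
  have hpoly : ∀ a, Differentiable ℂ fun z : ℂ × ℂ => (Lagrange.basis A id a).eval z.1 := fun a =>
    (Lagrange.basis A id a).differentiable.comp (f := fun z : ℂ × ℂ => z.1) differentiable_fst
  have hHd : DifferentiableOn ℂ H bidisc := by
    refine DifferentiableOn.fun_sum fun a ha => (hpoly a).differentiableOn.mul ?_
    exact (hg a ha).comp (f := Prod.snd) differentiableOn_snd fun z hz => hz.2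
  have hBd : Differentiable ℂ fun z : ℂ × ℂ => ∏ b ∈ B, (z.2 - b) :=
    differentiable_prod_sub differentiable_snd B
  obtain ⟨G, hG, hFG⟩ := exists_eq_prod_mul A (hF.sub (hBd.differentiableOn.mul hHd)) hA (by
    intro a ha y hy
    have h1 : H (a, y) = g a y := by
      rw [hH]
      simp only
      rw [Finset.sum_eq_single a]
      · have := Lagrange.eval_basis_self (s := A) (v := id) Function.injective_id.injOn ha
        simp only [id] at this
        rw [this, one_mul]
      · intro c hc hca
        have := Lagrange.eval_basis_of_ne (s := A) (v := id) hca ha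
        simp only [id] at this
        rw [this, zero_mul]
      · exact fun h => (h ha).elim
    simp [h1, hgF a ha y hy])
  refine ⟨G, H, hG, hHd, fun z hz => ?_⟩
  have := hFG z hz
  simp only [Pi.sub_apply, Pi.mul_apply] at this
  linear_combination this

/-- The element of `𝒪(Ω)` given by a function that is holomorphic on `Ω`. -/
def holoOfDifferentiableOn {E : Type*} [NormedAddCommGroup E] [NormedSpace ℂ E] {Ω : Set E}
    (F : E → ℂ) (hF : DifferentiableOn ℂ F Ω) : holo Ω :=
  ⟨fun z => F z, F, hF, fun _ => rfl⟩

/-- The ideal of a finite subset of the bidisc is finitely generated, and products of coordinate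
differences can be taken among the generators. -/
theorem exists_span_eq_vanishingIdeal (S : Finset (ℂ × ℂ)) (hS : (S : Set (ℂ × ℂ)) ⊆ bidisc) :
    ∃ ψ : Finset (holo bidisc), Ideal.span (ψ : Set (holo bidisc)) = vanishingIdeal bidisc S ∧
      (∃ f ∈ ψ, ∀ z : bidisc, f.1 z = ∏ a ∈ S.image Prod.fst, (z.1.1 - a)) ∧
      ∃ f ∈ ψ, ∀ z : bidisc, f.1 z = ∏ b ∈ S.image Prod.snd, (z.1.2 - b) := by
  classical
  set A := S.image Prod.fst with hA
  set B := S.image Prod.snd with hB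
  have hA1 : ∀ a ∈ A, a ∈ Metric.ball (0 : ℂ) 1 := by
    intro a ha
    obtain ⟨p, hp, rfl⟩ := Finset.mem_image.1 ha
    exact (hS hp).1
  have hB1 : ∀ b ∈ B, b ∈ Metric.ball (0 : ℂ) 1 := by
    intro b hb
    obtain ⟨p, hp, rfl⟩ := Finset.mem_image.1 hb
    exact (hS hp).2
  let PA : holo bidisc := holoOfDifferentiableOn (fun z => ∏ a ∈ A, (z.1 - a))
    (differentiable_prod_sub differentiable_fst A).differentiableOn
  let PB : holo bidisc := holoOfDifferentiableOn (fun z => ∏ b ∈ B, (z.2 - b))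
    (differentiable_prod_sub differentiable_snd B).differentiableOn
  -- `lag p` is the indicator of `p` on the grid `A × B`; for `p ∉ S` it lies in the ideal and
  -- serves as a generator.
  let lag : ℂ × ℂ → ℂ × ℂ → ℂ := fun p z =>
    (Lagrange.basis A id p.1).eval z.1 * (Lagrange.basis B id p.2).eval z.2
  have hlag : ∀ p, Differentiable ℂ (lag p) := fun p =>
    ((Lagrange.basis A id p.1).differentiable.comp (f := fun z : ℂ × ℂ => z.1)
      differentiable_fst).mul ((Lagrange.basis B id p.2).differentiable.comp
      (f := fun z : ℂ × ℂ => z.2) differentiable_snd)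
  have hlag_self : ∀ p ∈ A ×ˢ B, lag p p = 1 := by
    intro p hp
    obtain ⟨h1, h2⟩ := Finset.mem_product.1 hp
    have e1 := Lagrange.eval_basis_self (s := A) (v := id) Function.injective_id.injOn h1
    have e2 := Lagrange.eval_basis_self (s := B) (v := id) Function.injective_id.injOn h2
    simp only [id] at e1 e2
    simp only [lag, e1, e2, mul_one]
  have hlag_ne : ∀ p, ∀ q ∈ A ×ˢ B, p ≠ q → lag p q = 0 := by
    intro p q hq hpq
    obtain ⟨h1, h2⟩ := Finset.mem_product.1 hq
    by_cases h : p.1 = q.1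
    · have h' : p.2 ≠ q.2 := fun h' => hpq (Prod.ext h h')
      have := Lagrange.eval_basis_of_ne (s := B) (v := id) h' h2
      simp only [id] at this
      simp only [lag, this, mul_zero]
    · have := Lagrange.eval_basis_of_ne (s := A) (v := id) h h1
      simp only [id] at this
      simp only [lag, this, zero_mul]
  have hSAB : ∀ p ∈ S, p ∈ A ×ˢ B := fun p hp =>
    Finset.mem_product.2 ⟨Finset.mem_image_of_mem _ hp, Finset.mem_image_of_mem _ hp⟩
  let Lp : ℂ × ℂ → holo bidisc := fun p => holoOfDifferentiableOn (lag p) (hlag p).differentiableOn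
  let ψ : Finset (holo bidisc) := insert PA (insert PB (((A ×ˢ B) \ S).image Lp))
  have hPAψ : PA ∈ ψ := Finset.mem_insert_self _ _
  have hPBψ : PB ∈ ψ := Finset.mem_insert_of_mem (Finset.mem_insert_self _ _)
  refine ⟨ψ, le_antisymm ?_ ?_, ⟨PA, hPAψ, fun _ => rfl⟩, ⟨PB, hPBψ, fun _ => rfl⟩⟩
  · rw [Ideal.span_le]
    intro f hf z hz
    rcases Finset.mem_insert.1 hf with rfl | hf
    · exact Finset.prod_eq_zero (Finset.mem_image_of_mem Prod.fst hz) (sub_self _)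
    rcases Finset.mem_insert.1 hf with rfl | hf
    · exact Finset.prod_eq_zero (Finset.mem_image_of_mem Prod.snd hz) (sub_self _)
    obtain ⟨p, hp, rfl⟩ := Finset.mem_image.1 hf
    refine hlag_ne p z (hSAB _ hz) ?_
    rintro rfl
    exact (Finset.mem_sdiff.1 hp).2 hz
  · rintro f hf
    obtain ⟨F, hF, hfF⟩ := f.2
    have hF0 : ∀ p ∈ S, F p = 0 := fun p hp => by
      rw [← hfF ⟨p, hS hp⟩]
      exact hf ⟨p, hS hp⟩ hp
    -- Subtracting this sum makes `F` vanish on the whole grid.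
    have hsum : DifferentiableOn ℂ
        (fun z => ∑ p ∈ (A ×ˢ B) \ S, F p * lag p z) bidisc :=
      DifferentiableOn.fun_sum fun p _ => ((hlag p).const_mul (F p)).differentiableOn
    obtain ⟨G, H, hG, hH, hFGH⟩ := exists_eq_prod_mul_add_prod_mul hA1 hB1 (hF.sub hsum) (by
      intro a ha b hb
      have hab : (a, b) ∈ A ×ˢ B := Finset.mem_product.2 ⟨ha, hb⟩
      simp only [Pi.sub_apply]
      by_cases hS' : (a, b) ∈ S
      · rw [hF0 _ hS', zero_sub, neg_eq_zero]
        refine Finset.sum_eq_zero fun p hp => ?_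
        rw [hlag_ne p _ hab, mul_zero]
        rintro rfl
        exact (Finset.mem_sdiff.1 hp).2 hS'
      · rw [Finset.sum_eq_single (a, b)]
        · rw [hlag_self _ hab]
          ring
        · intro p _ hpa
          rw [hlag_ne p _ hab hpa, mul_zero]
        · exact fun h => (h (Finset.mem_sdiff.2 ⟨hab, hS'⟩)).elim)
    have hfeq : f = holoOfDifferentiableOn G hG * PA + holoOfDifferentiableOn H hH * PB +
        ∑ p ∈ (A ×ˢ B) \ S, algebraMap ℂ (holo bidisc) (F p) * Lp p := by
      refine Subtype.ext (funext fun z => ?_)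
      have h1 := hFGH z z.2
      simp only [Pi.sub_apply] at h1
      rw [hfF z]
      simp only [Subalgebra.coe_add, Subalgebra.coe_mul, AddSubmonoidClass.coe_finsetSum,
        Pi.add_apply, Pi.mul_apply, Finset.sum_apply, Subalgebra.coe_algebraMap,
        Pi.algebraMap_apply, Algebra.algebraMap_self, RingHom.id_apply]
      change F z = G z * (∏ a ∈ A, ((z : ℂ × ℂ).1 - a)) + H z * (∏ b ∈ B, ((z : ℂ × ℂ).2 - b)) +
        ∑ p ∈ (A ×ˢ B) \ S, F p * lag p z
      linear_combination h1
    rw [hfeq]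
    refine Ideal.add_mem _ (Ideal.add_mem _ ?_ ?_) (Ideal.sum_mem _ fun p hp => ?_)
    · exact Ideal.mul_mem_left _ _ (Ideal.subset_span hPAψ)
    · exact Ideal.mul_mem_left _ _ (Ideal.subset_span hPBψ)
    · exact Ideal.mul_mem_left _ _ (Ideal.subset_span
        (Finset.mem_insert_of_mem (Finset.mem_insert_of_mem (Finset.mem_image_of_mem _ hp))))

/-- For `a ∉ S`, each `s ∈ S` differs from `a` in some coordinate; the product of these coordinate
differences vanishes on `S` but not at `a`. -/
theorem mem_of_mem_zeroLocus_vanishingIdeal {S : Finset (ℂ × ℂ)} {a : bidisc}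
    (ha : a ∈ zeroLocus (vanishingIdeal bidisc S)) : (a : ℂ × ℂ) ∈ S := by
  classical
  by_contra haS
  let F : ℂ × ℂ → ℂ := fun z => ∏ s ∈ S, if s.1 = a.1.1 then z.2 - s.2 else z.1 - s.1
  have hF : Differentiable ℂ F := by
    refine differentiable_prod S
      (f := fun (s z : ℂ × ℂ) => if s.1 = a.1.1 then z.2 - s.2 else z.1 - s.1) fun s => ?_
    split_ifs <;> fun_prop
  have h0 := ha (holoOfDifferentiableOn F hF.differentiableOn) (by
    intro z hz
    refine Finset.prod_eq_zero hz ?_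
    split_ifs <;> simp)
  obtain ⟨s, hs, h⟩ := Finset.prod_eq_zero_iff.1 h0
  split_ifs at h with h1
  · exact haS (Prod.ext h1.symm (sub_eq_zero.1 h) ▸ hs)
  · exact h1 (sub_eq_zero.1 h).symm

/-! ### Admissible competitors -/

theorem exists_norm_sub_le_norm_prod (A : Finset ℂ) {a : ℂ} (ha : a ∈ A) :
    ∃ C : ℝ, 0 < C ∧ ∀ᶠ z in 𝓝 a, ‖z - a‖ ≤ C * ‖∏ b ∈ A, (z - b)‖ := by
  set q : ℂ → ℂ := fun z => ∏ b ∈ A.erase a, (z - b) with hq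
  have hqx : 0 < ‖q a‖ := by
    rw [norm_pos_iff, hq]
    exact Finset.prod_ne_zero_iff.2 fun b hb => sub_ne_zero.2 (Finset.ne_of_mem_erase hb).symm
  have hqc : Continuous q := by fun_prop
  refine ⟨(‖q a‖ / 2)⁻¹, by positivity, ?_⟩
  filter_upwards [hqc.norm.continuousAt.eventually (lt_mem_nhds (half_lt_self hqx))] with z hz
  rw [← Finset.mul_prod_erase A _ ha, norm_mul, ← div_eq_inv_mul, le_div_iff₀ (by positivity)]
  exact mul_le_mul_of_nonneg_left hz.le (norm_nonneg _)

/-- If `‖F‖ ^ p` is `O(‖z - a‖)` at each point `a` of `S`, then `log ‖F‖ ^ p` has the singularities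
of `ℐ(S)`. -/
theorem hasSingularity_log_rpow_enorm (S : Finset (ℂ × ℂ)) (hS : (S : Set (ℂ × ℂ)) ⊆ bidisc)
    {F : ℂ × ℂ → ℂ} {p : ℝ} (hp : 0 < p)
    (hF : ∀ a ∈ S, ∃ C : ℝ, ∀ᶠ z in 𝓝 a, ‖F z‖ ^ p ≤ C * ‖z - a‖) :
    HasSingularity (vanishingIdeal bidisc S) fun z => ENNReal.log (‖F z‖ₑ ^ p) := by
  obtain ⟨ψ, hψ, ⟨f, hf, hfz⟩, ⟨g, hg, hgz⟩⟩ := exists_span_eq_vanishingIdeal S hS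
  refine ⟨ψ, hψ, fun a ha => ?_⟩
  have haS := mem_of_mem_zeroLocus_vanishingIdeal ha
  obtain ⟨C, hC⟩ := hF a haS
  obtain ⟨C₁, hC₁0, hC₁⟩ := exists_norm_sub_le_norm_prod (S.image Prod.fst)
    (Finset.mem_image_of_mem Prod.fst haS)
  obtain ⟨C₂, hC₂0, hC₂⟩ := exists_norm_sub_le_norm_prod (S.image Prod.snd)
    (Finset.mem_image_of_mem Prod.snd haS)
  set D : ℝ := (|C| + 1) * (C₁ + C₂) with hD
  have hD0 : 0 < D := by positivity
  have key : ∀ (x : ℂ) (h : holo bidisc) (z : bidisc), h ∈ ψ → ‖x‖ ^ p ≤ D * ‖h.1 z‖ →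
      ENNReal.log (‖x‖ₑ ^ p) ≤ (⨆ f ∈ ψ, ENNReal.log ‖f.1 z‖ₑ) + (Real.log D : EReal) := by
    intro x h z hh hle
    have h1 : ‖x‖ₑ ^ p ≤ ‖h.1 z‖ₑ * ENNReal.ofReal D := by
      rw [← ofReal_norm, ← ofReal_norm, ENNReal.ofReal_rpow_of_nonneg (norm_nonneg _) hp.le,
        ← ENNReal.ofReal_mul (norm_nonneg _), mul_comm]
      exact ENNReal.ofReal_le_ofReal hle
    refine (ENNReal.log_le_log h1).trans ?_
    rw [ENNReal.log_mul_add, ENNReal.log_ofReal_of_pos hD0]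
    gcongr
    exact le_iSup₂ (f := fun (f : holo bidisc) (_ : f ∈ ψ) => ENNReal.log ‖f.1 z‖ₑ) h hh
  refine ⟨Real.log D, ?_⟩
  have e1 := (continuous_fst.comp continuous_subtype_val).continuousAt (x := a) |>.eventually hC₁
  have e2 := (continuous_snd.comp continuous_subtype_val).continuousAt (x := a) |>.eventually hC₂
  have e3 := continuous_subtype_val.continuousAt (x := a) |>.eventually hC
  filter_upwards [e1, e2, e3] with z h1 h2 h3
  simp only [Function.comp_apply] at h1 h2
  rw [← hfz] at h1
  rw [← hgz] at h2
  have h4 : ‖F z‖ ^ p ≤ (|C| + 1) * ‖(z : ℂ × ℂ) - a‖ :=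
    h3.trans (mul_le_mul_of_nonneg_right (by linarith [le_abs_self C]) (norm_nonneg _))
  -- The norm of `ℂ × ℂ` is the maximum norm, so one of the two coordinate generators controls the
  -- distance to `a`.
  have hmax : ‖(z : ℂ × ℂ) - a‖ = max ‖(z : ℂ × ℂ).1 - (a : ℂ × ℂ).1‖
    ‖(z : ℂ × ℂ).2 - (a : ℂ × ℂ).2‖ := rfl
  rcases max_choice ‖(z : ℂ × ℂ).1 - (a : ℂ × ℂ).1‖ ‖(z : ℂ × ℂ).2 - (a : ℂ × ℂ).2‖ with h | h
  · refine key _ f z hf (h4.trans ?_)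
    rw [hmax, h, hD, mul_assoc]
    gcongr
    nlinarith [norm_nonneg (f.1 z)]
  · refine key _ g z hg (h4.trans ?_)
    rw [hmax, h, hD, mul_assoc]
    gcongr
    nlinarith [norm_nonneg (g.1 z)]

/-- Two factors vanish at `a` and the third is bounded, so the product is `O(‖z - a‖²)`. -/
theorem exists_rpow_half_norm_mul_le {E : Type*} [NormedAddCommGroup E] [NormedSpace ℂ E]
    {f g h : E → ℂ} (hf : Differentiable ℂ f) (hg : Differentiable ℂ g) (hh : Differentiable ℂ h)
    {a : E} (hfa : f a = 0) (hga : g a = 0) :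
    ∃ C : ℝ, ∀ᶠ z in 𝓝 a, ‖f z * g z * h z‖ ^ (1 / 2 : ℝ) ≤ C * ‖z - a‖ := by
  have hf' : f =O[𝓝 a] fun z => z - a := by simpa [hfa] using (hf a).isBigO_sub
  have hg' : g =O[𝓝 a] fun z => z - a := by simpa [hga] using (hg a).isBigO_sub
  have hh' : h =O[𝓝 a] fun _ => (1 : ℝ) := (hh a).continuousAt.isBigO_one ℝ
  have hO := ((hf'.norm_right.mul hg'.norm_right).mul hh')
  obtain ⟨c, hc0, hc⟩ := hO.exists_nonneg
  refine ⟨c ^ (1 / 2 : ℝ), ?_⟩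
  filter_upwards [hc.bound] with z hz
  calc ‖f z * g z * h z‖ ^ (1 / 2 : ℝ) ≤ (c * ‖z - a‖ ^ 2) ^ (1 / 2 : ℝ) := by
        refine Real.rpow_le_rpow (norm_nonneg _) (hz.trans_eq ?_) (by norm_num)
        simp [pow_two]
    _ = c ^ (1 / 2 : ℝ) * ‖z - a‖ := by
        rw [Real.mul_rpow hc0 (by positivity), ← Real.sqrt_eq_rpow, ← Real.sqrt_eq_rpow,
          Real.sqrt_sq (norm_nonneg _)]

theorem log_rpow_enorm_le_green {S : Finset (ℂ × ℂ)} (hS : (S : Set (ℂ × ℂ)) ⊆ bidisc)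
    {F : ℂ × ℂ → ℂ} (hF : DifferentiableOn ℂ F bidisc) (hF1 : ∀ z ∈ bidisc, ‖F z‖ ≤ 1) {p : ℝ}
    (hp : 0 < p) (hFS : ∀ a ∈ S, ∃ C : ℝ, ∀ᶠ z in 𝓝 a, ‖F z‖ ^ p ≤ C * ‖z - a‖) (z : ℂ × ℂ) :
    ENNReal.log (‖F z‖ₑ ^ p) ≤ green bidisc S z := by
  refine le_sSup ⟨_, ⟨plurisubharmonicOn_log_rpow_enorm hF hp, fun w hw => ?_⟩,
    hasSingularity_log_rpow_enorm S hS hp hFS, rfl⟩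
  rw [ENNReal.log_le_zero_iff]
  refine ENNReal.rpow_le_one ?_ hp.le
  rw [← ofReal_norm]
  exact ENNReal.ofReal_le_one.2 (hF1 w hw)

/-! ### Lower bound: the three lines -/

/-- The product of the three lines through two of the poles, normalized to be at most `1` on the
bidisc. -/
noncomputable def lineProduct (ε ρ δ : ℂ) (z : ℂ × ℂ) : ℂ :=
  z.2 * (z.2 - δ * z.1) *
    ((z.2 - δ * (ρ / (ρ - ε)) * (z.1 - ε)) * ((1 + ‖δ‖ : ℝ) * (1 + 2 * ‖δ‖ : ℝ) : ℂ)⁻¹)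

/-- Since `‖ρ‖ ≤ ‖ρ - ε‖`, the third line has slope at most `‖δ‖` in modulus, so the three factors
are at most `1`, `1 + ‖δ‖` and `1 + 2‖δ‖` on the bidisc. -/
theorem log_lineProduct_le_green {ε ρ δ : ℂ} (hε : ‖ε‖ < 1) (hρ : ‖ρ‖ < 1) (hδ : ‖δ‖ < 1)
    (hρε : ‖ρ‖ ≤ ‖ρ - ε‖) (hρ0 : ρ ≠ 0) (z : ℂ × ℂ) :
    ENNReal.log (‖lineProduct ε ρ δ z‖ₑ ^ (1 / 2 : ℝ)) ≤ green bidisc (poles ε ρ δ) z := by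
  classical
  have hne : ρ - ε ≠ 0 := norm_pos_iff.1 ((norm_pos_iff.2 hρ0).trans_le hρε)
  have hpoles : poles ε ρ δ = (({(0, 0), (ε, 0), (ρ, δ * ρ)} : Finset (ℂ × ℂ)) : Set (ℂ × ℂ)) := by
    simp [poles]
  rw [hpoles]
  have h2 : Differentiable ℂ fun z : ℂ × ℂ => z.2 - δ * z.1 := by fun_prop
  have h3 : Differentiable ℂ fun z : ℂ × ℂ => (z.2 - δ * (ρ / (ρ - ε)) * (z.1 - ε)) *
    ((1 + ‖δ‖ : ℝ) * (1 + 2 * ‖δ‖ : ℝ) : ℂ)⁻¹ := by fun_prop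
  refine log_rpow_enorm_le_green ?_ ?_ ?_ (by norm_num) ?_ z
  · intro p hp
    simp only [Finset.coe_insert, Finset.coe_singleton, mem_insert_iff, mem_singleton_iff] at hp
    rcases hp with rfl | rfl | rfl
    · simp [bidisc]
    · simpa [bidisc] using hε
    · have : ‖δ‖ * ‖ρ‖ < 1 := mul_lt_one_of_nonneg_of_lt_one_left (norm_nonneg _) hδ hρ.le
      simpa [bidisc] using ⟨hρ, this⟩
  · exact ((differentiable_snd.mul h2).mul h3).differentiableOn
  · intro z hz
    have hz1 : ‖z.1‖ ≤ 1 := by simpa using (mem_ball_zero_iff.1 hz.1).le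
    have hz2 : ‖z.2‖ ≤ 1 := by simpa using (mem_ball_zero_iff.1 hz.2).le
    have e2 : ‖z.2 - δ * z.1‖ ≤ 1 + ‖δ‖ := by
      refine (norm_sub_le _ _).trans (add_le_add hz2 ?_)
      rw [norm_mul]
      exact mul_le_of_le_one_right (norm_nonneg _) hz1
    have e3 : ‖z.2 - δ * (ρ / (ρ - ε)) * (z.1 - ε)‖ ≤ 1 + 2 * ‖δ‖ := by
      refine (norm_sub_le _ _).trans (add_le_add hz2 ?_)
      have e4 : ‖ρ / (ρ - ε)‖ ≤ 1 := by
        rw [norm_div]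
        exact div_le_one_of_le₀ hρε (norm_nonneg _)
      have e5 : ‖z.1 - ε‖ ≤ 2 := (norm_sub_le _ _).trans (by linarith)
      rw [norm_mul, norm_mul]
      calc ‖δ‖ * ‖ρ / (ρ - ε)‖ * ‖z.1 - ε‖ ≤ ‖δ‖ * 1 * 2 := by gcongr
        _ = 2 * ‖δ‖ := by ring
    have hδ1 : 0 < 1 + ‖δ‖ := by positivity
    have hδ2 : 0 < 1 + 2 * ‖δ‖ := by positivity
    simp only [lineProduct, norm_mul, norm_inv, Complex.norm_real, Real.norm_eq_abs, abs_of_pos hδ1,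
      abs_of_pos hδ2]
    rw [← mul_assoc, ← div_eq_mul_inv, div_le_one (by positivity)]
    calc ‖z.2‖ * ‖z.2 - δ * z.1‖ * ‖z.2 - δ * (ρ / (ρ - ε)) * (z.1 - ε)‖
        ≤ 1 * (1 + ‖δ‖) * (1 + 2 * ‖δ‖) := by gcongr
      _ = _ := by ring
  · intro a ha
    simp only [Finset.mem_insert, Finset.mem_singleton] at ha
    rcases ha with rfl | rfl | rfl
    · exact exists_rpow_half_norm_mul_le differentiable_snd h2 h3 rfl (by simp)
    · have := exists_rpow_half_norm_mul_le (a := (ε, (0 : ℂ))) differentiable_snd h3 h2 rfl (by simp)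
      simpa only [lineProduct, mul_right_comm] using this
    · have := exists_rpow_half_norm_mul_le (a := (ρ, δ * ρ)) h2 h3 differentiable_snd (by simp) (by
        rw [mul_eq_zero]
        left
        field_simp
        ring)
      refine this.imp fun C hC => hC.mono fun z hz => ?_
      rw [lineProduct, mul_assoc, mul_comm]
      exact hz

theorem tendsto_log_lineProduct {l : Filter ℂ} {ρ δ : ℂ → ℂ} (hε : Tendsto id l (𝓝 (0 : ℂ)))
    (hρ : ∀ᶠ ε in l, ‖ρ ε‖ ≤ ‖ρ ε - ε‖) (hδ : Tendsto δ l (𝓝 0)) {z : ℂ × ℂ} (hz : z.2 ≠ 0) :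
    Tendsto (fun ε => ENNReal.log (‖lineProduct ε (ρ ε) (δ ε) z‖ₑ ^ (1 / 2 : ℝ))) l
      (𝓝 (((3 / 2 : ℝ) * Real.log ‖z.2‖ : ℝ) : EReal)) := by
  have hκ : Tendsto (fun ε => δ ε * (ρ ε / (ρ ε - ε))) l (𝓝 0) := by
    refine squeeze_zero_norm' (a := fun ε => ‖δ ε‖) ?_ (by simpa using hδ.norm)
    filter_upwards [hρ] with ε h
    rw [norm_mul, norm_div]
    exact mul_le_of_le_one_right (norm_nonneg _) (div_le_one_of_le₀ h (norm_nonneg _))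
  have hn : Tendsto (fun ε => ‖δ ε‖) l (𝓝 0) := by simpa using hδ.norm
  have hM : Tendsto (fun ε => ((1 + ‖δ ε‖ : ℝ) * (1 + 2 * ‖δ ε‖ : ℝ) : ℂ)⁻¹) l (𝓝 1) := by
    have h1 : Tendsto (fun ε => (1 + ‖δ ε‖) * (1 + 2 * ‖δ ε‖)) l (𝓝 1) := by
      simpa using (hn.const_add 1).mul ((hn.const_mul 2).const_add 1)
    have h2 := (Complex.continuous_ofReal.tendsto 1).comp h1
    simpa [Function.comp_def] using h2.inv₀ (by simp)
  have hF : Tendsto (fun ε => lineProduct ε (ρ ε) (δ ε) z) l (𝓝 (z.2 * z.2 * z.2)) := by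
    have h1 : Tendsto (fun ε => z.2 - δ ε * z.1) l (𝓝 z.2) := by
      simpa using (hδ.mul_const z.1).const_sub z.2
    have h2 : Tendsto (fun ε => z.2 - δ ε * (ρ ε / (ρ ε - ε)) * (z.1 - ε)) l (𝓝 z.2) := by
      simpa using (hκ.mul (hε.const_sub z.1)).const_sub z.2
    simpa [lineProduct] using (h1.const_mul z.2).mul (h2.mul hM)
  have hval : ENNReal.log (‖z.2 * z.2 * z.2‖ₑ ^ (1 / 2 : ℝ)) =
      (((3 / 2 : ℝ) * Real.log ‖z.2‖ : ℝ) : EReal) := by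
    have hz' : ‖z.2‖ ≠ 0 := norm_ne_zero_iff.2 hz
    rw [ENNReal.log_rpow, log_enorm_eq (by simpa using hz), ← EReal.coe_mul, norm_mul, norm_mul,
      Real.log_mul (by positivity) hz', Real.log_mul hz' hz']
    congr 1
    ring
  rw [← hval]
  exact (ENNReal.continuous_log.tendsto _).comp
    (((ENNReal.continuous_rpow_const (y := 1 / 2)).tendsto _).comp hF.enorm)

/-! ### Upper bound: discs through the poles -/

/-- Upper bound for the Green function at a point of a holomorphic disc through the poles. -/
theorem green_le_of_disc {E : Type*} [NormedAddCommGroup E] [NormedSpace ℂ E] {Ω S : Set E}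
    {Φ : ℂ → E} (hΦ : DifferentiableOn ℂ Φ (Metric.ball 0 1))
    (hΦΩ : MapsTo Φ (Metric.ball 0 1) Ω) {Z : Finset ℂ} (hZ1 : ∀ a ∈ Z, ‖a‖ < 1)
    (hZS : ∀ a ∈ Z, Φ a ∈ S) {ζ₀ : ℂ} (hζ1 : ‖ζ₀‖ < 1) (hζ₀ : ζ₀ ∉ Z) :
    green Ω S (Φ ζ₀) ≤
      ((Real.log ‖∏ a ∈ Z, (ζ₀ - a)‖ - Real.log (∏ a ∈ Z, (1 - ‖a‖)) : ℝ) : EReal) := by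
  refine sSup_le ?_
  rintro _ ⟨u, ⟨hu, hu0⟩, ⟨ψ, hψ, hsing⟩, rfl⟩
  refine le_log_of_subharmonicOn (hu.2.2 Φ hΦ hΦΩ) (fun ζ hζ => hu0 _ (hΦΩ hζ)) ?_ hZ1 hζ1 hζ₀
  intro a ha
  have haB : a ∈ Metric.ball (0 : ℂ) 1 := mem_ball_zero_iff.2 (hZ1 a ha)
  have hBn : Metric.ball (0 : ℂ) 1 ∈ 𝓝 a := Metric.isOpen_ball.mem_nhds haB
  obtain ⟨C, hC⟩ := hsing ⟨Φ a, hΦΩ haB⟩ fun f hf => hf _ (hZS a ha)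
  have hlim : Tendsto Φ (𝓝 a) (𝓝[Ω] Φ a) :=
    tendsto_nhdsWithin_iff.2 ⟨(hΦ.continuousOn.continuousAt hBn).tendsto,
      Filter.mem_of_superset hBn hΦΩ⟩
  have hC' : ∀ᶠ x in 𝓝[Ω] Φ a, ∃ h : x ∈ Ω,
      u x ≤ (⨆ f ∈ ψ, ENNReal.log ‖f.1 ⟨x, h⟩‖ₑ) + (C : EReal) := by
    rw [← map_nhds_subtype_val ⟨Φ a, hΦΩ haB⟩, Filter.eventually_map]
    exact hC.mono fun z hz => ⟨z.2, hz⟩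
  -- Each generator vanishes at the pole `Φ a`, so along the disc it is `O(|ζ - a|)`; this turns the
  -- singularity condition into a logarithmic pole at `a`.
  have hf : ∀ f ∈ ψ, ∃ c : ℝ, 0 ≤ c ∧ ∀ᶠ ζ in 𝓝 a, ∀ h : Φ ζ ∈ Ω,
      ‖f.1 ⟨Φ ζ, h⟩‖ ≤ c * ‖ζ - a‖ := by
    intro f hf
    obtain ⟨F, hF, hfF⟩ := f.2
    have hfI : f ∈ vanishingIdeal Ω S := hψ ▸ Ideal.subset_span hf
    have hFa : F (Φ a) = 0 := by
      rw [← hfF ⟨Φ a, hΦΩ haB⟩]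
      exact hfI _ (hZS a ha)
    have hd : DifferentiableAt ℂ (F ∘ Φ) a := (hF.comp hΦ hΦΩ).differentiableAt hBn
    obtain ⟨c, hc0, hc⟩ := hd.isBigO_sub.exists_nonneg
    refine ⟨c, hc0, hc.bound.mono fun ζ hζ h => ?_⟩
    rw [hfF]
    simpa [hFa] using hζ
  choose! c hc0 hc using hf
  refine ⟨Real.log (∑ f ∈ ψ, c f + 1) + C, ?_⟩
  have hD : 0 < ∑ f ∈ ψ, c f + 1 := by
    have := Finset.sum_nonneg hc0
    linarith
  filter_upwards [hlim.eventually hC', (Finset.eventually_all ψ).2 hc] with ζ h1 h2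
  obtain ⟨hΩ, h1⟩ := h1
  refine h1.trans ?_
  rw [EReal.coe_add, ← add_assoc]
  gcongr
  refine iSup₂_le fun f hf => ?_
  rw [← ENNReal.log_ofReal_of_pos hD, ← ENNReal.log_mul_add, ENNReal.log_le_log_iff,
    ← ofReal_norm, ← ofReal_norm, ← ENNReal.ofReal_mul (norm_nonneg _)]
  refine ENNReal.ofReal_le_ofReal ((h2 f hf hΩ).trans ?_)
  rw [mul_comm]
  gcongr
  have := Finset.single_le_sum hc0 hf
  linarith

/-- The disc `ζ ↦ (ε ζ / s + c ζ (ζ - s) + e ζ (ζ - s) (ζ - t), ζ (ζ - s))`. -/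
noncomputable def cubicDisc (ε c s t e ζ : ℂ) : ℂ × ℂ :=
  (ε / s * ζ + c * (ζ * (ζ - s)) + e * (ζ * (ζ - s) * (ζ - t)), ζ * (ζ - s))

theorem cubicDisc_mem_bidisc {ε c s t e ζ : ℂ} {R : ℝ} (hζ : ‖ζ‖ ≤ R) (hR : R ≤ 1)
    (h2 : R * (R + ‖s‖) < 1)
    (h1 : ‖ε / s‖ + ‖c‖ * (R * (R + ‖s‖)) + ‖e‖ * ((1 + ‖s‖) * (1 + ‖t‖)) < 1) :
    cubicDisc ε c s t e ζ ∈ bidisc := by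
  have hR0 : 0 ≤ R := (norm_nonneg _).trans hζ
  have e1 : ‖ζ * (ζ - s)‖ ≤ R * (R + ‖s‖) := by
    rw [norm_mul]
    gcongr
    exact (norm_sub_le _ _).trans (by gcongr)
  have e2 : ‖ζ * (ζ - s) * (ζ - t)‖ ≤ (1 + ‖s‖) * (1 + ‖t‖) := by
    rw [norm_mul]
    have h3 : ‖ζ - t‖ ≤ 1 + ‖t‖ := (norm_sub_le _ _).trans (by linarith)
    have h4 : ‖ζ * (ζ - s)‖ ≤ 1 + ‖s‖ := by linarith [norm_nonneg s]
    gcongr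
  refine ⟨mem_ball_zero_iff.2 ?_, mem_ball_zero_iff.2 (e1.trans_lt h2)⟩
  refine (norm_add₃_le).trans_lt (lt_of_le_of_lt ?_ h1)
  rw [norm_mul (ε / s), norm_mul c, norm_mul e]
  gcongr
  exact mul_le_of_le_one_right (norm_nonneg _) (hζ.trans hR)

/-- The disc is run at `R ζ`, so the nodes are `0, s / R, t / R`, and `ζ₀ (ζ₀ - s) = z₂` turns the
product over them into `z₂ (ζ₀ - t) / R³`. The `e` term vanishes at all three nodes and is free to
adjust the first coordinate at `ζ₀`. -/
theorem green_le_of_cubicDisc {ε ρ δ c s t e ζ₀ : ℂ} {z : ℂ × ℂ} {R : ℝ} (hs0 : s ≠ 0)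
    (ht0 : t ≠ 0) (hts : t ≠ s) (ht1 : ε / s * t + c * (δ * ρ) = ρ) (ht2 : t * (t - s) = δ * ρ)
    (hz2 : ζ₀ * (ζ₀ - s) = z.2) (hz1 : ε / s * ζ₀ + c * z.2 + e * (z.2 * (ζ₀ - t)) = z.1)
    (hz0 : z.2 ≠ 0) (hζt : ζ₀ ≠ t) (hR1 : R < 1) (hsR : ‖s‖ < R) (htR : ‖t‖ < R)
    (hζR : ‖ζ₀‖ < R) (h2 : R * (R + ‖s‖) < 1)
    (h1 : ‖ε / s‖ + ‖c‖ * (R * (R + ‖s‖)) + ‖e‖ * ((1 + ‖s‖) * (1 + ‖t‖)) < 1) :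
    green bidisc (poles ε ρ δ) z ≤ ((Real.log (‖z.2‖ * ‖ζ₀ - t‖ / R ^ 3) -
      Real.log ((1 - ‖s‖ / R) * (1 - ‖t‖ / R)) : ℝ) : EReal) := by
  classical
  have hR0 : 0 < R := (norm_nonneg _).trans_lt hsR
  have hRC : (R : ℂ) ≠ 0 := by exact_mod_cast hR0.ne'
  have hζ0 : ζ₀ ≠ 0 := by
    rintro rfl
    exact hz0 (by rw [← hz2, zero_mul])
  have hζs : ζ₀ ≠ s := by
    rintro rfl
    exact hz0 (by rw [← hz2, sub_self, mul_zero])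
  have hnorm : ∀ x : ℂ, ‖x / R‖ = ‖x‖ / R := fun x => by
    rw [norm_div, Complex.norm_real, Real.norm_of_nonneg hR0.le]
  have hlt : ∀ x : ℂ, ‖x‖ < R → ‖x / R‖ < 1 := fun x hx => by
    rw [hnorm, div_lt_one hR0]
    exact hx
  have hmul : ∀ x : ℂ, (R : ℂ) * (x / R) = x := fun x => mul_div_cancel₀ x hRC
  have hdiv : ∀ {x y : ℂ}, x ≠ y → x / (R : ℂ) ≠ y / R := fun hxy h =>
    hxy ((div_left_inj' hRC).1 h)
  set Φ : ℂ → ℂ × ℂ := fun ζ => cubicDisc ε c s t e (R * ζ) with hΦ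
  have hΦz : Φ (ζ₀ / R) = z := by
    simp only [hΦ, hmul, cubicDisc]
    rw [hz2, hz1]
  have h0s : (0 : ℂ) ∉ ({s / (R : ℂ), t / (R : ℂ)} : Finset ℂ) := by
    simp [hs0, ht0, hRC, eq_comm]
  have hst : s / (R : ℂ) ∉ ({t / (R : ℂ)} : Finset ℂ) := by
    simpa using hdiv hts.symm
  have key := green_le_of_disc (Ω := bidisc) (S := poles ε ρ δ) (Φ := Φ)
    (Z := {0, s / (R : ℂ), t / (R : ℂ)}) (ζ₀ := ζ₀ / R) ?_ ?_ ?_ ?_ (hlt _ hζR) ?_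
  · rw [hΦz, Finset.prod_insert h0s, Finset.prod_insert hst, Finset.prod_singleton,
      Finset.prod_insert h0s, Finset.prod_insert hst, Finset.prod_singleton] at key
    have e1 : (ζ₀ / R - 0) * ((ζ₀ / R - s / R) * (ζ₀ / R - t / R)) =
        z.2 * (ζ₀ - t) / (R : ℂ) ^ 3 := by
      rw [← hz2]
      field_simp
      ring
    rw [e1, norm_div, norm_mul, norm_pow, Complex.norm_real, Real.norm_of_nonneg hR0.le, norm_zero,
      sub_zero, one_mul, hnorm, hnorm] at key
    exact key
  · have : Differentiable ℂ Φ := by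
      simp only [hΦ, cubicDisc]
      fun_prop
    exact this.differentiableOn
  · intro ζ hζ
    refine cubicDisc_mem_bidisc (R := R) ?_ hR1.le h2 h1
    rw [norm_mul, Complex.norm_real, Real.norm_of_nonneg hR0.le]
    exact mul_le_of_le_one_right hR0.le (mem_ball_zero_iff.1 hζ).le
  · intro a ha
    simp only [Finset.mem_insert, Finset.mem_singleton] at ha
    rcases ha with rfl | rfl | rfl
    · simp
    · exact hlt _ hsR
    · exact hlt _ htR
  · intro a ha
    simp only [Finset.mem_insert, Finset.mem_singleton] at ha
    rcases ha with rfl | rfl | rfl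
    · left
      simp [hΦ, cubicDisc]
    · right; left
      simp [hΦ, cubicDisc, hmul, hs0]
    · right; right
      simp only [hΦ, cubicDisc, hmul, ht2, sub_self, mul_zero, add_zero, ht1, mem_singleton_iff]
  · simp only [Finset.mem_insert, Finset.mem_singleton, not_or]
    exact ⟨div_ne_zero hζ0 hRC, hdiv hζs, hdiv hζt⟩

/-- The parameters of the discs through three poles. -/
theorem exists_node {ε ρ δ c : ℂ} (hε : ε ≠ 0) (hρ : ρ ≠ 0) (hρ1 : ‖ρ‖ ≤ ‖ε‖)
    (hρ2 : ‖ρ‖ ≤ ‖ρ - ε‖) (hδ : δ ≠ 0) (hc : ‖c‖ ≤ 1) (hδ2 : ‖δ‖ ≤ 1 / 2) :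
    ∃ s t : ℂ, s ≠ 0 ∧ t ≠ 0 ∧ t ≠ s ∧ ε / s * t + c * (δ * ρ) = ρ ∧ t * (t - s) = δ * ρ ∧
      ‖s‖ ^ 2 ≤ 8 * ‖δ‖ * ‖ε‖ ∧ ‖t‖ ≤ 2 * ‖s‖ ∧ ‖ε / s‖ ^ 2 ≤ 6 * (‖ε‖ / ‖δ‖) := by
  have hε' : 0 < ‖ε‖ := norm_pos_iff.2 hε
  have hδ' : 0 < ‖δ‖ := norm_pos_iff.2 hδ
  have hcδ : ‖c * δ‖ ≤ 1 / 2 := by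
    rw [norm_mul]
    nlinarith [norm_nonneg c]
  set x : ℂ := 1 - c * δ with hx
  set y : ℂ := ρ - ε - c * δ * ρ with hy
  have hx1 : 1 / 2 ≤ ‖x‖ := by
    have := norm_sub_norm_le (1 : ℂ) (c * δ)
    rw [norm_one] at this
    linarith
  have hx2 : ‖x‖ ≤ 2 := by
    have := norm_sub_le (1 : ℂ) (c * δ)
    rw [norm_one] at this
    linarith
  have hcδρ : ‖c * δ * ρ‖ ≤ 1 / 2 * ‖ρ‖ := by
    rw [norm_mul]
    gcongr
  -- `‖ρ‖ ≤ ‖ρ - ε‖` gives `‖ε‖ ≤ 2 ‖ρ - ε‖`, and the perturbation costs at most half of `‖ρ - ε‖`.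
  have hy1 : 1 / 4 * ‖ε‖ ≤ ‖y‖ := by
    have h1 := norm_sub_norm_le (ρ - ε) (c * δ * ρ)
    have h2 : ‖ε‖ ≤ ‖ρ‖ + ‖ρ - ε‖ := by
      simpa using norm_sub_le ρ (ρ - ε)
    linarith
  have hy2 : ‖y‖ ≤ 3 * ‖ε‖ := by
    have h1 := norm_sub_le (ρ - ε) (c * δ * ρ)
    have h2 := norm_sub_le ρ ε
    linarith
  have hx0 : x ≠ 0 := norm_pos_iff.1 (by linarith)
  have hy0 : y ≠ 0 := norm_pos_iff.1 (by linarith)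
  -- The first-coordinate equation at `t` gives `t = (ρ / ε) x s`, whence `t - s = s y / ε`; then `t
  -- (t - s) = δ ρ` becomes `s² = δ ε² / (x y)`.
  obtain ⟨s, hs⟩ := IsAlgClosed.exists_pow_nat_eq (δ * ε ^ 2 / (x * y)) (n := 2) two_pos
  have hs0 : s ≠ 0 := by
    rintro rfl
    refine (div_ne_zero (mul_ne_zero hδ (pow_ne_zero 2 hε)) (mul_ne_zero hx0 hy0)) ?_
    rw [← hs]
    ring
  have hsn : ‖s‖ ^ 2 * (‖x‖ * ‖y‖) = ‖δ‖ * ‖ε‖ ^ 2 := by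
    rw [← norm_mul, ← norm_pow, ← norm_mul, hs, div_mul_cancel₀ _ (mul_ne_zero hx0 hy0), norm_mul,
      norm_pow]
  have hs' : 0 < ‖s‖ := norm_pos_iff.2 hs0
  have hxy : ‖x‖ * ‖y‖ ≤ 6 * ‖ε‖ := by
    calc ‖x‖ * ‖y‖ ≤ 2 * (3 * ‖ε‖) := by gcongr
      _ = 6 * ‖ε‖ := by ring
  have hxy' : 1 / 8 * ‖ε‖ ≤ ‖x‖ * ‖y‖ := by
    calc 1 / 8 * ‖ε‖ = 1 / 2 * (1 / 4 * ‖ε‖) := by ring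
      _ ≤ ‖x‖ * ‖y‖ := by gcongr
  refine ⟨s, ρ / ε * x * s, hs0, by positivity, ?_, ?_, ?_, ?_, ?_, ?_⟩
  · intro h
    have h1 : (ρ / ε * x - 1) * s = 0 := by linear_combination h
    rcases mul_eq_zero.1 h1 with h2 | h2
    · apply hy0
      field_simp at h2
      rw [hy]
      rw [hx] at h2
      linear_combination h2
    · exact hs0 h2
  · rw [hx]
    field_simp
    ring
  · have h1 : ρ / ε * x * s * (ρ / ε * x * s - s) = s ^ 2 * (ρ / ε * x * (ρ / ε * x - 1)) := by ring
    have h2 : ρ / ε * x - 1 = y / ε := by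
      rw [hx, hy]
      field_simp
      ring
    rw [h1, hs, h2]
    field_simp
  · have h1 : ‖s‖ ^ 2 * (1 / 8 * ‖ε‖) ≤ ‖δ‖ * ‖ε‖ ^ 2 := by
      rw [← hsn]
      gcongr
    refine le_of_mul_le_mul_right ?_ hε'
    linarith
  · rw [norm_mul, norm_mul, norm_div]
    have : ‖ρ‖ / ‖ε‖ ≤ 1 := div_le_one_of_le₀ hρ1 hε'.le
    calc ‖ρ‖ / ‖ε‖ * ‖x‖ * ‖s‖ ≤ 1 * 2 * ‖s‖ := by gcongr
      _ = 2 * ‖s‖ := by ring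
  · have h1 : ‖δ‖ * ‖ε‖ ^ 2 ≤ ‖s‖ ^ 2 * (6 * ‖ε‖) := by
      rw [← hsn]
      gcongr
    rw [norm_div, div_pow, div_le_iff₀ (by positivity), mul_assoc, div_mul_eq_mul_div,
      ← mul_div_assoc, le_div_iff₀ hδ']
    linarith

/-- Once the ratio of logarithms is below `1/2`, `‖δ‖ > ‖ε‖^(1/2)` because `log ‖ε‖ < 0`; hence `‖ε‖
/ ‖δ‖ ≤ √‖ε‖`. -/
theorem tendsto_norm_div_norm {l : Filter ℂ} {δ : ℂ → ℂ} (hid : Tendsto id l (𝓝 (0 : ℂ)))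
    (hε : ∀ᶠ ε in l, ε ≠ 0) (hδ0 : ∀ᶠ ε in l, δ ε ≠ 0)
    (hlog : Tendsto (fun ε => Real.log ‖δ ε‖ / Real.log ‖ε‖) l (𝓝 0)) :
    Tendsto (fun ε => ‖ε‖ / ‖δ ε‖) l (𝓝 0) := by
  have hn : Tendsto (fun ε : ℂ => ‖ε‖) l (𝓝 0) := by simpa using hid.norm
  have hsq : Tendsto (fun ε : ℂ => √‖ε‖) l (𝓝 0) := by
    simpa [Function.comp_def] using (Real.continuous_sqrt.tendsto 0).comp hn
  refine squeeze_zero' (Eventually.of_forall fun ε => by positivity) ?_ hsq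
  filter_upwards [hε, hδ0, hlog.eventually (gt_mem_nhds (half_pos one_pos)),
    hn.eventually (gt_mem_nhds one_pos)] with ε h1 h2 h3 h4
  have h1' : 0 < ‖ε‖ := norm_pos_iff.2 h1
  have h2' : 0 < ‖δ ε‖ := norm_pos_iff.2 h2
  rw [div_lt_iff_of_neg (Real.log_neg h1' h4)] at h3
  rw [← Real.exp_log (Real.sqrt_pos.2 h1'), ← Real.exp_log (div_pos h1' h2'), Real.exp_le_exp,
    Real.log_div h1'.ne' h2'.ne', Real.log_sqrt h1'.le]
  linarith

theorem tendsto_norm_of_sq_le {l : Filter ℂ} {f : ℂ → ℂ} {g : ℂ → ℝ} (hg : Tendsto g l (𝓝 0))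
    (hfg : ∀ᶠ x in l, ‖f x‖ ^ 2 ≤ g x) : Tendsto f l (𝓝 0) := by
  have hsq : Tendsto (fun x => √(g x)) l (𝓝 0) := by
    simpa [Function.comp_def] using (Real.continuous_sqrt.tendsto 0).comp hg
  exact squeeze_zero_norm' (hfg.mono fun x hx => Real.le_sqrt_of_sq_le hx) hsq

theorem eventually_green_lt {l : Filter ℂ} {ρ δ : ℂ → ℂ} (hid : Tendsto id l (𝓝 (0 : ℂ)))
    (hε : ∀ᶠ ε in l, ε ≠ 0) (hρ0 : ∀ᶠ ε in l, ρ ε ≠ 0) (hρ1 : ∀ᶠ ε in l, ‖ρ ε‖ ≤ ‖ε‖)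
    (hρ2 : ∀ᶠ ε in l, ‖ρ ε‖ ≤ ‖ρ ε - ε‖) (hδ0 : ∀ᶠ ε in l, δ ε ≠ 0) (hδ : Tendsto δ l (𝓝 0))
    (hεδ : Tendsto (fun ε => ‖ε‖ / ‖δ ε‖) l (𝓝 0)) {z : ℂ × ℂ} (hz2 : z.2 ≠ 0) (hz21 : ‖z.2‖ < 1)
    (hz12 : ‖z.1‖ ≤ ‖z.2‖) {b : ℝ} (hb : 3 / 2 * Real.log ‖z.2‖ < b) :
    ∀ᶠ ε in l, green bidisc (poles ε (ρ ε) (δ ε)) z < (b : EReal) := by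
  have hz2' : 0 < ‖z.2‖ := norm_pos_iff.2 hz2
  have hsqz : 0 < √‖z.2‖ := Real.sqrt_pos.2 hz2'
  -- `R < 1` leaves room for the perturbed disc inside the bidisc; by continuity at `R = 1` it costs
  -- less than the gap up to `b`.
  obtain ⟨R, hRb, hRz, hR1⟩ : ∃ R : ℝ, Real.log (‖z.2‖ * √‖z.2‖ / R ^ 3) < b ∧ √‖z.2‖ < R ∧
      R < 1 := by
    have hcont : ContinuousAt (fun R : ℝ => Real.log (‖z.2‖ * √‖z.2‖ / R ^ 3)) 1 := by
      refine ContinuousAt.log (ContinuousAt.div (by fun_prop) (by fun_prop) (by simp)) ?_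
      simpa only [one_pow, div_one] using (mul_pos hz2' hsqz).ne'
    have hval : Real.log (‖z.2‖ * √‖z.2‖ / 1 ^ 3) < b := by
      rw [one_pow, div_one, Real.log_mul hz2'.ne' hsqz.ne', Real.log_sqrt hz2'.le]
      linarith
    have h1 : √‖z.2‖ < 1 := by
      rw [Real.sqrt_lt' one_pos]
      simpa using hz21
    have hev : ∀ᶠ R in 𝓝[<] (1 : ℝ), Real.log (‖z.2‖ * √‖z.2‖ / R ^ 3) < b ∧ √‖z.2‖ < R ∧
        R < 1 :=
      ((hcont.eventually (gt_mem_nhds hval)).filter_mono nhdsWithin_le_nhds).and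
        (((lt_mem_nhds h1).filter_mono nhdsWithin_le_nhds).and self_mem_nhdsWithin)
    exact hev.exists
  have hR0 : 0 < R := hsqz.trans hRz
  set c : ℂ := z.1 / z.2 with hc
  have hc1 : ‖c‖ ≤ 1 := by
    rw [hc, norm_div]
    exact div_le_one_of_le₀ hz12 (norm_nonneg _)
  have hcz : c * z.2 = z.1 := div_mul_cancel₀ _ hz2
  have hn : Tendsto (fun ε : ℂ => ‖ε‖) l (𝓝 0) := by simpa using hid.norm
  have hδn : Tendsto (fun ε => ‖δ ε‖) l (𝓝 0) := by simpa using hδ.norm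
  have hex : ∀ᶠ ε in l, ∃ st : ℂ × ℂ, st.1 ≠ 0 ∧ st.2 ≠ 0 ∧ st.2 ≠ st.1 ∧
      ε / st.1 * st.2 + c * (δ ε * ρ ε) = ρ ε ∧ st.2 * (st.2 - st.1) = δ ε * ρ ε ∧
      ‖st.1‖ ^ 2 ≤ 8 * ‖δ ε‖ * ‖ε‖ ∧ ‖st.2‖ ≤ 2 * ‖st.1‖ ∧
      ‖ε / st.1‖ ^ 2 ≤ 6 * (‖ε‖ / ‖δ ε‖) := by
    filter_upwards [hε, hρ0, hρ1, hρ2, hδ0, hδn.eventually (gt_mem_nhds (half_pos one_pos))]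
      with ε h1 h2 h3 h4 h5 h6
    obtain ⟨s, t, h⟩ := exists_node h1 h2 h3 h4 h5 hc1 h6.le
    exact ⟨(s, t), h⟩
  obtain ⟨st, hst⟩ := Filter.skolem.1 hex
  set s : ℂ → ℂ := fun ε => (st ε).1 with hs
  set t : ℂ → ℂ := fun ε => (st ε).2 with ht
  have hs_lim : Tendsto s l (𝓝 0) :=
    tendsto_norm_of_sq_le (by simpa using (hδn.const_mul 8).mul hn)
      (hst.mono fun ε h => h.2.2.2.2.2.1)
  have hsn : Tendsto (fun ε => ‖s ε‖) l (𝓝 0) := by simpa using hs_lim.norm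
  have ht_lim : Tendsto t l (𝓝 0) :=
    squeeze_zero_norm' (hst.mono fun ε h => h.2.2.2.2.2.2.1) (by simpa using hsn.const_mul 2)
  have htn : Tendsto (fun ε => ‖t ε‖) l (𝓝 0) := by simpa using ht_lim.norm
  have hεs : Tendsto (fun ε => ε / s ε) l (𝓝 0) :=
    tendsto_norm_of_sq_le (by simpa using hεδ.const_mul 6) (hst.mono fun ε h => h.2.2.2.2.2.2.2)
  have hεsn : Tendsto (fun ε => ‖ε / s ε‖) l (𝓝 0) := by simpa using hεs.norm
  have hroot : ∀ x : ℂ, ∃ w, w ^ 2 = x := fun x => IsAlgClosed.exists_pow_nat_eq x two_pos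
  choose r hr using hroot
  -- Then `s / 2 + w` solves `ζ (ζ - s) = z₂`. The chosen square root may jump between branches, so
  -- only norms are shown to converge.
  set w : ℂ → ℂ := fun ε => r (z.2 + s ε ^ 2 / 4) with hw
  have hw_lim : Tendsto (fun ε => ‖w ε‖) l (𝓝 √‖z.2‖) := by
    have h1 : ∀ ε, ‖w ε‖ = √‖z.2 + s ε ^ 2 / 4‖ := fun ε => by
      rw [← hr (z.2 + s ε ^ 2 / 4), norm_pow, Real.sqrt_sq (norm_nonneg _)]
    simp only [h1]
    have h2 : Tendsto (fun ε => z.2 + s ε ^ 2 / 4) l (𝓝 z.2) := by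
      simpa using ((hs_lim.pow 2).div_const 4).const_add z.2
    exact (Real.continuous_sqrt.tendsto _).comp h2.norm
  have hadd : ∀ f : ℂ → ℂ, Tendsto f l (𝓝 0) →
      Tendsto (fun ε => ‖w ε + f ε‖) l (𝓝 √‖z.2‖) := by
    intro f hf
    have h1 : Tendsto (fun ε => ‖w ε + f ε‖ - ‖w ε‖) l (𝓝 0) := by
      refine squeeze_zero_norm (a := fun ε => ‖f ε‖) (fun ε => ?_) (by simpa using hf.norm)
      simpa using abs_norm_sub_norm_le (w ε + f ε) (w ε)
    simpa using h1.add hw_lim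
  set ζ : ℂ → ℂ := fun ε => s ε / 2 + w ε with hζ
  have hζ_eq : ∀ ε, ζ ε * (ζ ε - s ε) = z.2 := fun ε => by
    have h := hr (z.2 + s ε ^ 2 / 4)
    simp only [hζ, hw]
    linear_combination h
  have hζ_lim : Tendsto (fun ε => ‖ζ ε‖) l (𝓝 √‖z.2‖) :=
    (hadd (fun ε => s ε / 2) (by simpa using hs_lim.div_const 2)).congr fun ε => by
      simp only [hζ, add_comm]
  have hζt_lim : Tendsto (fun ε => ‖ζ ε - t ε‖) l (𝓝 √‖z.2‖) :=
    (hadd (fun ε => s ε / 2 - t ε) (by simpa using (hs_lim.div_const 2).sub ht_lim)).congr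
      fun ε => by
        simp only [hζ]
        congr 1
        ring
  -- Chosen to cancel `(ε / s) ζ` at the target parameter, where `c z₂ = z₁` is already the right
  -- first coordinate.
  set e : ℂ → ℂ := fun ε => -(ε / s ε * ζ ε) / (z.2 * (ζ ε - t ε)) with he
  have he_lim : Tendsto (fun ε => ‖e ε‖) l (𝓝 0) := by
    have h1 : Tendsto (fun ε => ‖ε / s ε‖ * ‖ζ ε‖ / (‖z.2‖ * ‖ζ ε - t ε‖)) l (𝓝 0) := by
      simpa [Pi.div_def] using (hεsn.mul hζ_lim).div (hζt_lim.const_mul ‖z.2‖)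
        (mul_pos hz2' hsqz).ne'
    simpa only [he, norm_div, norm_neg, norm_mul] using h1
  have hmap2 : Tendsto (fun ε => R * (R + ‖s ε‖)) l (𝓝 (R * R)) := by
    simpa using (hsn.const_add R).const_mul R
  have hmap1 : Tendsto (fun ε => ‖ε / s ε‖ + ‖c‖ * (R * (R + ‖s ε‖)) +
      ‖e ε‖ * ((1 + ‖s ε‖) * (1 + ‖t ε‖))) l (𝓝 (‖c‖ * (R * R))) := by
    simpa using (hεsn.add (hmap2.const_mul ‖c‖)).add
      (he_lim.mul ((hsn.const_add 1).mul (htn.const_add 1)))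
  have hRR : R * R < 1 := by nlinarith
  have hcRR : ‖c‖ * (R * R) < 1 := by nlinarith [norm_nonneg c]
  have hU : Tendsto (fun ε => Real.log (‖z.2‖ * ‖ζ ε - t ε‖ / R ^ 3) -
      Real.log ((1 - ‖s ε‖ / R) * (1 - ‖t ε‖ / R))) l
      (𝓝 (Real.log (‖z.2‖ * √‖z.2‖ / R ^ 3))) := by
    have h1 := ((hζt_lim.const_mul ‖z.2‖).div_const (R ^ 3)).log (by positivity)
    have h2 := (((hsn.div_const R).const_sub 1).mul ((htn.div_const R).const_sub 1)).log (by simp)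
    simpa using h1.sub h2
  filter_upwards [hst, hU.eventually (gt_mem_nhds hRb), hmap1.eventually (gt_mem_nhds hcRR),
    hmap2.eventually (gt_mem_nhds hRR), hsn.eventually (gt_mem_nhds hR0),
    htn.eventually (gt_mem_nhds hR0), hζ_lim.eventually (gt_mem_nhds hRz),
    hζt_lim.eventually (lt_mem_nhds hsqz)] with ε h1 h2 h3 h4 h5 h6 h7 h8
  have hζt : ζ ε - t ε ≠ 0 := norm_pos_iff.1 h8
  refine lt_of_le_of_lt (green_le_of_cubicDisc h1.1 h1.2.1 h1.2.2.1 h1.2.2.2.1 h1.2.2.2.2.1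
    (hζ_eq ε) ?_ hz2 (sub_ne_zero.1 hζt) hR1 h5 h6 h7 h4 h3) (EReal.coe_lt_coe_iff.2 h2)
  have h9 : e ε * (z.2 * (ζ ε - t ε)) = -(ε / s ε * ζ ε) :=
    div_mul_cancel₀ _ (mul_ne_zero hz2 hζt)
  rw [h9, hcz]
  ring

end PluriGreen

/-! ### The limit -/

theorem corollary5
    (E : Set ℂ) (hE : (0 : ℂ) ∈ closure E) (hE0 : (0 : ℂ) ∉ E)
    (ρ δ : ℂ → ℂ)
    (hρ0 : ∀ ε ∈ E, ρ ε ≠ 0)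
    (hρ1 : ∀ ε ∈ E, ‖ρ ε‖ ≤ ‖ε‖)
    (hρ2 : ∀ ε ∈ E, ‖ρ ε‖ ≤ ‖ρ ε - ε‖)
    (hδ0 : ∀ ε ∈ E, δ ε ≠ 0)
    (hδ : Tendsto δ (𝓝[E] 0) (𝓝 0))
    (hlog : Tendsto (fun ε => Real.log ‖δ ε‖ / Real.log ‖ε‖) (𝓝[E] 0) (𝓝 0))
    (z : ℂ × ℂ) (hz : z ∈ PluriGreen.bidisc) (hz0 : z ≠ (0, 0)) (hz12 : ‖z.1‖ ≤ ‖z.2‖) :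
    Tendsto (fun ε => PluriGreen.green PluriGreen.bidisc (PluriGreen.poles ε (ρ ε) (δ ε)) z)
      (𝓝[E] 0) (𝓝 (((3 / 2 : ℝ) * Real.log ‖z.2‖ : ℝ) : EReal)) := by
  have hid : Tendsto id (𝓝[E] (0 : ℂ)) (𝓝 0) := nhdsWithin_le_nhds
  have hE' : ∀ {p : ℂ → Prop}, (∀ ε ∈ E, p ε) → ∀ᶠ ε in 𝓝[E] (0 : ℂ), p ε := fun h =>
    eventually_nhdsWithin_of_forall h
  have hε : ∀ᶠ ε in 𝓝[E] (0 : ℂ), ε ≠ 0 := hE' fun ε hε h => hE0 (h ▸ hε)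
  have hz2 : z.2 ≠ 0 := by
    intro h
    rw [h, norm_zero, norm_le_zero_iff] at hz12
    exact hz0 (Prod.ext hz12 h)
  have hn : Tendsto (fun ε : ℂ => ‖ε‖) (𝓝[E] 0) (𝓝 0) := by simpa using hid.norm
  have hδn : Tendsto (fun ε => ‖δ ε‖) (𝓝[E] 0) (𝓝 0) := by simpa using hδ.norm
  rw [tendsto_order]
  constructor
  · intro b hb
    filter_upwards [(PluriGreen.tendsto_log_lineProduct hid (hE' hρ2) hδ hz2).eventually
      (lt_mem_nhds hb), hE' hρ0, hE' hρ1, hE' hρ2, hn.eventually (gt_mem_nhds one_pos),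
      hδn.eventually (gt_mem_nhds one_pos)] with ε h1 h2 h3 h4 h5 h6
    exact h1.trans_le
      (PluriGreen.log_lineProduct_le_green h5 (h3.trans_lt h5) h6 h4 h2 z)
  · intro b hb
    obtain ⟨b', hb1, hb2⟩ := EReal.lt_iff_exists_real_btwn.1 hb
    filter_upwards [PluriGreen.eventually_green_lt hid hε (hE' hρ0) (hE' hρ1) (hE' hρ2) (hE' hδ0)
      hδ (PluriGreen.tendsto_norm_div_norm hid hε (hE' hδ0) hlog) hz2 (mem_ball_zero_iff.1 hz.2)
      hz12 (EReal.coe_lt_coe_iff.1 hb1)] with ε h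
    exact h.trans hb2
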